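/- Let $0<v_{\min}<v_{\max}<\infty$ and let $p_-,p_+:\mathbb R\to[0,\infty)$ be even, integrable, of positive integral, with $p_\pm(v)=0$ whenever $|v|\le v_{\min}$ or $|v|\ge v_{\max}$ (velocity cutoff). For $k\ge 0$ put $$F_k^-=\int_{v_{\min}}^{v_{\max}}v^kp_-(v)\,dv,\qquad F_k^+=\int_{-v_{\max}}^{-v_{\min}}v^kp_+(v)\,dv,\qquad Q_k=F_k^--F_k^+ ,$$ and assume mechanical equilibrium, $Q_2=0$. Fix $\bar V\in(0,v_{\min}/3)$. A piston of mass $M$ starts at the origin of the real line with velocity $u\in[-\bar V,\bar V]$, in a gas of non-interacting atoms of mass $m$ whose initial positions and velocities $(x,v)$ form a Poisson process on $\mathbb R^2$ with density $p_-(v)$ for $x<0$ and $p_+(v)$ for $x>0$. Between collisions the piston and the atoms move with constant velocities. When the piston, with velocity $V$, meets an atom, with velocity $v$, the velocity of the atom becomes $-\frac{M-m}{M+m}v+\frac{2M}{M+m}V$; with $V'=\frac{M-m}{M+m}V+\frac{2m}{M+m}v$, the velocity of the piston becomes $V'$ if $|V'|\le\bar V$, $2\bar V-V'$ if $V'>\bar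 V$, and $-2\bar V-V'$ if $V'<-\bar V$. Let $W(t)$ be the velocity of the piston at time $t$ and $\mathcal P(u,dw;t)$ the law of $W(t)$ given $W(0)=u$. Let $\mu_0$ be a stationary measure of $W$, i.e. a probability measure on $[-\bar V,\bar V]$ with $\int\mathcal P(u,\cdot\,;t)\,d\mu_0(u)=\mu_0$ for all $t\ge0$. Write $\langle W^k\rangle=\int w^k\,d\mu_0(w)$ and $\varepsilon=m/M$. Then there are constants $C,c,\varepsilon_0>0$, depending only on $v_{\min},v_{\max},\bar V,p_-,p_+$, such that for all $m,M>0$ with $\varepsilon\le\varepsilon_0$ and every such $\mu_0$ $$\Big|\langle W^2\rangle-\frac{Q_3}{2Q_1}\,\varepsilon\Big|\le C\varepsilon^2,\qquad \Big|\langle W\rangle-\frac{Q_0Q_3}{4Q_1^2}\,\varepsilon\Big|\le C\varepsilon^2 .$$ Moreover the first and second moment identities hold up to an exponentially small effect of the reflection: $$\big|Q_2-2Q_1\langle W\rangle+Q_0\langle W^2\rangle\big|\le Ce^{-c/\varepsilon},$$ $$\Big|2Q_1\langle W^2\rangle-Q_0\langle W^3\rangle-\frac{m}{M+m}\big(Q_3+3Q_1\langle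 W^2\rangle-Q_0\langle W^3\rangle\big)\Big|\le Ce^{-c/\varepsilon}.$$ -/

import Mathlib

open MeasureTheory ProbabilityTheory Filter Topology Set
open scoped ENNReal NNReal

noncomputable section

namespace Piston

/-! ### The gases -/

/-- `p = n f` with `n > 0` and `f` an even probability density, subject to the velocity cutoff. -/
structure IsGasDensity (vmin vmax : ℝ) (p : ℝ → ℝ) : Prop where
  measurable : Measurable p
  nonneg : ∀ v, 0 ≤ p v
  even : ∀ v, p (-v) = p v
  integrable : Integrable p
  pos : 0 < ∫ v, p v
  cutoff : ∀ v, |v| ≤ vmin ∨ vmax ≤ |v| → p v = 0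

/-- `F_k^-`, the one-sided moments of the left gas. -/
def Fminus (vmin vmax : ℝ) (pminus : ℝ → ℝ) (k : ℕ) : ℝ :=
  ∫ v in vmin..vmax, v ^ k * pminus v

/-- `F_k^+`, the one-sided moments of the right gas. -/
def Fplus (vmin vmax : ℝ) (pplus : ℝ → ℝ) (k : ℕ) : ℝ :=
  ∫ v in (-vmax)..(-vmin), v ^ k * pplus v

/-- `Q_k = F_k^- - F_k^+`. -/
def Q (vmin vmax : ℝ) (pminus pplus : ℝ → ℝ) (k : ℕ) : ℝ :=
  Fminus vmin vmax pminus k - Fplus vmin vmax pplus k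

/-- The measure `p(x,v) dx dv` on the `(x,v)`-plane, with `p(x,v) = p_-(v)` for `x < 0` and
`p(x,v) = p_+(v)` for `x > 0`. -/
def gasIntensity (pminus pplus : ℝ → ℝ) : Measure (ℝ × ℝ) :=
  volume.withDensity fun a => ENNReal.ofReal (if a.1 < 0 then pminus a.2 else pplus a.2)

/-- The random set of points `ξ` is a Poisson process with intensity measure `ν`: the number of
points in `D` is Poisson with parameter `ν D`, and the numbers of points in disjoint sets are
independent. -/
structure IsPoissonProcess {Ω E : Type*} [MeasurableSpace Ω] [MeasurableSpace E]
    (P : Measure Ω) (ξ : Ω → Set E) (ν : Measure E) : Prop where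
  measurable_count : ∀ D, MeasurableSet D → Measurable fun ω => (ξ ω ∩ D).encard
  count_law : ∀ D, MeasurableSet D → ν D ≠ ∞ → ∀ k : ℕ,
    P {ω | (ξ ω ∩ D).encard = k} = poissonMeasure (ν D).toNNReal {k}
  indep : ∀ (n : ℕ) (D : Fin n → Set E), (∀ i, MeasurableSet (D i)) →
    Pairwise (Function.onFun Disjoint D) → iIndepFun (fun i ω => (ξ ω ∩ D i).encard) P

/-! ### The mechanics -/

/-- Velocity of the piston after an elastic collision. -/
def pistonAfter (m M V v : ℝ) : ℝ := (M - m) / (M + m) * V + 2 * m / (M + m) * v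

/-- Velocity of the atom after an elastic collision. -/
def atomAfter (m M V v : ℝ) : ℝ := -((M - m) / (M + m)) * v + 2 * M / (M + m) * V

/-- Reflection of the piston velocity at `±Vbar`. -/
def reflect (Vbar V : ℝ) : ℝ :=
  if Vbar < V then 2 * Vbar - V else if V < -Vbar then -2 * Vbar - V else V

/-- `f` has the constant value `c` immediately before time `t`. -/
def JustBefore (f : ℝ → ℝ) (t c : ℝ) : Prop := ∀ᶠ s in 𝓝[<] t, f s = c

/-- On `[0, ∞)`, `f` is a right-continuous step function with locally finitely many jumps. -/
structure IsStep (f : ℝ → ℝ) : Prop where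
  right : ∀ t, 0 ≤ t → ∀ᶠ s in 𝓝[>] t, f s = f t
  left : ∀ t, 0 < t → ∃ c, JustBefore f t c

/-- The evolution, for times `t ≥ 0`, of a piston (position `X`, velocity `W`, started at the origin
with velocity `u`) and of the atoms, with the reflection rule for the piston velocity. The set `A`
consists of the initial positions and velocities of the atoms; the atom that starts from `a ∈ A`
has position `y a` and velocity `w a`. Atoms do not interact with each other. -/
structure Evolution (m M Vbar u : ℝ) (A : Set (ℝ × ℝ)) (X W : ℝ → ℝ)
    (y w : ℝ × ℝ → ℝ → ℝ) : Prop where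
  piston_start : W 0 = u
  atom_start : ∀ a ∈ A, w a 0 = a.2
  piston_step : IsStep W
  atom_step : ∀ a ∈ A, IsStep (w a)
  piston_position : ∀ t, 0 ≤ t → X t = ∫ s in (0 : ℝ)..t, W s
  atom_position : ∀ a ∈ A, ∀ t, 0 ≤ t → y a t = a.1 + ∫ s in (0 : ℝ)..t, w a s
  single : ∀ t, 0 < t → ∀ a ∈ A, ∀ b ∈ A, y a t = X t → y b t = X t → a = b
  piston_free : ∀ t, 0 < t → (∀ a ∈ A, y a t ≠ X t) → JustBefore W t (W t)
  atom_free : ∀ a ∈ A, ∀ t, 0 < t → y a t ≠ X t → JustBefore (w a) t (w a t)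
  collision : ∀ a ∈ A, ∀ t, 0 < t → y a t = X t → ∀ V v, JustBefore W t V →
    JustBefore (w a) t v →
      W t = reflect Vbar (pistonAfter m M V v) ∧ w a t = atomAfter m M V v

/-! ### The velocity process and its stationary measures -/

/-- `κ t u` is, for `t ≥ 0` and `u ∈ [-Vbar, Vbar]`, the transition probability of the velocity
process `W`: the law of `W t` when `W 0 = u` and the piston moves in a Poisson gas. -/
def IsTransitionProbability (m M Vbar : ℝ) (pminus pplus : ℝ → ℝ) (κ : ℝ → Kernel ℝ ℝ) : Prop :=
  ∀ u ∈ Icc (-Vbar) Vbar,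
    ∃ (Ω : Type) (_ : MeasurableSpace Ω) (P : Measure Ω) (ξ : Ω → Set (ℝ × ℝ)) (W : ℝ → Ω → ℝ),
      IsProbabilityMeasure P ∧
      IsPoissonProcess P ξ (gasIntensity pminus pplus) ∧
      (∀ t, 0 ≤ t → AEMeasurable (W t) P) ∧
      (∀ᵐ ω ∂P, ∃ (X : ℝ → ℝ) (y w : ℝ × ℝ → ℝ → ℝ),
        Evolution m M Vbar u (ξ ω) X (fun t => W t ω) y w) ∧
      ∀ t, 0 ≤ t → κ t u = P.map (W t)

/-- `μ` is a stationary probability measure, on `[-Vbar, Vbar]`, of the velocity process `W`. -/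
structure IsStationary (m M Vbar : ℝ) (pminus pplus : ℝ → ℝ) (μ : Measure ℝ) : Prop where
  prob : IsProbabilityMeasure μ
  support : ∀ᵐ u ∂μ, u ∈ Icc (-Vbar) Vbar
  invariant : ∃ κ : ℝ → Kernel ℝ ℝ, IsTransitionProbability m M Vbar pminus pplus κ ∧
    ∀ t, 0 ≤ t → μ.bind (κ t) = μ

end Piston

end

namespace Piston

/-! ### Deterministic mechanics over a short time -/

/-! Only the behaviour of the piston over a short time `h` is needed. Up to probability `O(h²)` at
most one atom starts within `(vmax + Vbar) * h` of the piston. Such an atom either misses it or hits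
it once, because it leaves the collision faster than the piston can follow. Hence E f(W(h)) = f(u) +
h·Lf(u) + O(h²), uniformly in `u`, where L is `generator`. Integrating against a stationary measure,
dividing by `h` and letting `h → 0` gives ∫ Lf dμ = 0 for continuous `f`
(`IsStationary.integral_generator`). The Markov property is never used.

The rest is analysis of this identity for small `η = 2m/(M+m)`. A hit moves the piston by `η * (v -
u)` before reflection, so without reflection L applied to a polynomial involves the moments of `v -
u` under the signed gas density, which are polynomials in `u` with coefficients `Q_k`. The second
such moment is -2Q₁u + Q₀u² because Q₂ = 0; it is a restoring drift since |Q₀u| ≤ Q₁/3. With the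
test function exp(a u²/η) this drift beats the noise and yields an exponential moment bounded
uniformly in `η` (`integral_exp_le`): μ lives at scale √η.

Reflection matters only if |u| ≥ Vbar/2, which the exponential moment makes exponentially unlikely
(`abs_generator_sub_le`, `abs_integral_le`). The test functions w, w², w³ therefore give three
moment equations with exponentially small errors; the first two are the asserted identities. The
second involves ⟨W³⟩, for which concentration alone does not give `O(η²)`; the third equation, with
⟨W⁴⟩ = O(η²), does. Then the second equation yields ⟨W²⟩ and the first yields ⟨W⟩
(`exists_moment_expansion`). -/

lemma IsStep.eq_const_of_free {f : ℝ → ℝ} (hf : IsStep f) {s T c : ℝ} (hs : 0 ≤ s) (h0 : f s = c)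
    (h : ∀ t, s < t → t ≤ T → (∀ r ∈ Ico s t, f r = c) → JustBefore f t (f t)) :
    ∀ t ∈ Icc s T, f t = c := by
  -- At the first time `b` where constancy fails, the absence of a jump gives `f b = c`, and
  -- right-continuity extends this beyond `b`. The hypothesis `h` may assume constancy before `t`,
  -- so the absence of a collision can be derived from the trajectory already established.
  by_contra! hcon
  obtain ⟨t₀, ht₀, hne⟩ := hcon
  set B : Set ℝ := {t | t ∈ Icc s T ∧ f t ≠ c} with hB
  have hBne : B.Nonempty := ⟨t₀, ht₀, hne⟩
  have hBbd : BddBelow B := ⟨s, fun t ht => ht.1.1⟩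
  set b := sInf B with hb
  have hsb : s ≤ b := le_csInf hBne fun t ht => ht.1.1
  have hbT : b ≤ T := (csInf_le hBbd ⟨ht₀, hne⟩).trans ht₀.2
  have hbelow : ∀ r ∈ Ico s b, f r = c := by
    intro r hr
    by_contra hrc
    exact absurd (csInf_le hBbd ⟨⟨hr.1, hr.2.le.trans hbT⟩, hrc⟩) (not_le.2 hr.2)
  have hfb : f b = c := by
    rcases hsb.eq_or_lt with heq | hlt
    · rw [← heq, h0]
    · have h1 : ∀ᶠ r in 𝓝[<] b, f r = f b := h b hlt hbT hbelow
      have h2 : ∀ᶠ r in 𝓝[<] b, r ∈ Ioo s b := Ioo_mem_nhdsLT hlt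
      obtain ⟨r, hr1, hr2⟩ := (h1.and h2).exists
      rw [← hr1, hbelow r ⟨hr2.1.le, hr2.2⟩]
  have hright := hf.right b (hs.trans hsb)
  obtain ⟨d, hd, hdsub⟩ := mem_nhdsGT_iff_exists_Ioo_subset.1 hright
  have : d ≤ b := by
    refine le_csInf hBne fun t ht => ?_
    by_contra! htd
    rcases (csInf_le hBbd ht : b ≤ t).eq_or_lt with heq | hlt
    · exact ht.2 (heq ▸ hfb)
    · exact ht.2 ((hdsub ⟨hlt, htd⟩ : f t = f b).trans hfb)
  exact absurd hd (not_lt.2 this)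

lemma integral_eq_of_eqOn_Ico {f : ℝ → ℝ} {s t c : ℝ} (hst : s ≤ t) (h : ∀ r ∈ Ico s t, f r = c) :
    IntervalIntegrable f volume s t ∧ ∫ r in s..t, f r = c * (t - s) := by
  have hae : ∀ᵐ r ∂volume.restrict (Ioc s t), (fun _ => c) r = f r := by
    rw [← restrict_Ico_eq_restrict_Ioc]
    exact (ae_restrict_iff' measurableSet_Ico).2 (.of_forall fun r hr => (h r hr).symm)
  constructor
  · rw [intervalIntegrable_iff_integrableOn_Ioc_of_le hst]
    exact (integrableOn_const (by simp) (by simp)).congr hae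
  · rw [intervalIntegral.integral_of_le hst, ← integral_congr_ae hae,
      ← intervalIntegral.integral_of_le hst]
    simp [mul_comm]

lemma integral_eq_of_two_values {f : ℝ → ℝ} {s t c d : ℝ} (hs : 0 ≤ s) (hst : s ≤ t)
    (h : ∀ r ∈ Ico 0 s, f r = c) (h' : ∀ r ∈ Ico s t, f r = d) :
    ∫ r in (0 : ℝ)..t, f r = c * s + d * (t - s) := by
  obtain ⟨i₁, e₁⟩ := integral_eq_of_eqOn_Ico hs h
  obtain ⟨i₂, e₂⟩ := integral_eq_of_eqOn_Ico hst h'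
  rw [← intervalIntegral.integral_add_adjacent_intervals i₁ i₂, e₁, e₂, sub_zero]

namespace Evolution

variable {m M Vbar u : ℝ} {A : Set (ℝ × ℝ)} {X W : ℝ → ℝ} {y w : ℝ × ℝ → ℝ → ℝ}

lemma atom_free_flight (E : Evolution m M Vbar u A X W y w) {a : ℝ × ℝ} (ha : a ∈ A) {T : ℝ}
    (h : ∀ t ∈ Ioc 0 T, a.1 + a.2 * t ≠ X t) :
    ∀ t ∈ Icc 0 T, w a t = a.2 ∧ y a t = a.1 + a.2 * t := by
  have hy : ∀ t, 0 ≤ t → (∀ r ∈ Ico 0 t, w a r = a.2) → y a t = a.1 + a.2 * t := by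
    intro t ht hr
    rw [E.atom_position a ha t ht, (integral_eq_of_eqOn_Ico ht hr).2, sub_zero]
  have hw := (E.atom_step a ha).eq_const_of_free le_rfl (T := T) (E.atom_start a ha)
    fun t ht htT hr => E.atom_free a ha t ht (by rw [hy t ht.le hr]; exact h t ⟨ht, htT⟩)
  exact fun t ht => ⟨hw t ht, hy t ht.1 fun r hr => hw r ⟨hr.1, hr.2.le.trans ht.2⟩⟩

lemma piston_free_flight (E : Evolution m M Vbar u A X W y w) {T : ℝ}
    (h : ∀ a ∈ A, ∀ t ∈ Ioc 0 T, a.1 + a.2 * t ≠ u * t) : ∀ t ∈ Icc 0 T, W t = u := by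
  refine E.piston_step.eq_const_of_free le_rfl E.piston_start fun t ht htT hr => ?_
  refine E.piston_free t ht fun a ha => ?_
  -- Velocity on the half-open interval already fixes the position at the endpoint, so whether an
  -- atom is met at time `t` is decided before `W t` is known.
  have hX : ∀ s ∈ Icc 0 t, X s = u * s := fun s hs => by
    rw [E.piston_position s hs.1, (integral_eq_of_eqOn_Ico hs.1 fun r hr' =>
      hr r ⟨hr'.1, hr'.2.trans_le hs.2⟩).2, sub_zero]
  have hfree : ∀ s ∈ Ioc 0 t, a.1 + a.2 * s ≠ X s := fun s hs => by
    rw [hX s ⟨hs.1.le, hs.2⟩]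
    exact h a ha s ⟨hs.1, hs.2.trans htT⟩
  rw [(E.atom_free_flight ha hfree t ⟨ht.le, le_rfl⟩).2]
  exact hfree t ⟨ht, le_rfl⟩

/-- The motion is restarted at the collision time `τ`: from there piston and atom move on two
straight lines through a common point with different velocities (`hsep`), so they do not meet again.
All other atoms are too far away to arrive before `T`. -/
lemma piston_one_collision (E : Evolution m M Vbar u A X W y w) {vmax T τ : ℝ} {a : ℝ × ℝ}
    (hu : |u| ≤ Vbar) (ha : a ∈ A) (hau : a.2 ≠ u) (hτ : τ ∈ Ioc 0 T)
    (hhit : a.1 + a.2 * τ = u * τ)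
    (hfar : ∀ b ∈ A, b ≠ a → |b.2| ≤ vmax ∧ (vmax + Vbar) * T < |b.1|)
    (hbd : |reflect Vbar (pistonAfter m M u a.2)| ≤ Vbar)
    (hsep : atomAfter m M u a.2 ≠ reflect Vbar (pistonAfter m M u a.2)) :
    W T = reflect Vbar (pistonAfter m M u a.2) := by
  set V' := reflect Vbar (pistonAfter m M u a.2)
  set v' := atomAfter m M u a.2
  -- Stated for every position within `Vbar * t` of the origin, so that it serves both before and
  -- after the collision.
  have far : ∀ b ∈ A, b ≠ a → ∀ t ∈ Ioc 0 T, ∀ z, |z| ≤ Vbar * t → b.1 + b.2 * t ≠ z := by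
    intro b hb hba t ht z hz heq
    obtain ⟨h1, h2⟩ := hfar b hb hba
    have h3 : |b.1| ≤ |z| + |b.2| * t := by
      rw [show b.1 = z - b.2 * t by linarith]
      exact (abs_sub _ _).trans (by rw [abs_mul, abs_of_pos ht.1])
    have h0 : 0 ≤ vmax + Vbar := by linarith [abs_nonneg u, abs_nonneg b.2]
    nlinarith [mul_le_mul_of_nonneg_right h1 ht.1.le, mul_le_mul_of_nonneg_left ht.2 h0]
  have ahit : ∀ t, t ≠ τ → a.1 + a.2 * t ≠ u * t := by
    intro t ht heq
    have : (a.2 - u) * (t - τ) = 0 := by linarith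
    rcases mul_eq_zero.1 this with h | h
    · exact hau (by linarith)
    · exact ht (by linarith)
  have hut : ∀ t, 0 ≤ t → |u * t| ≤ Vbar * t := fun t ht => by
    rw [abs_mul, abs_of_nonneg ht]; gcongr
  have hW : ∀ t ∈ Ico 0 τ, W t = u := by
    intro t ht
    refine E.piston_free_flight (T := t) (fun b hb s hs => ?_) t ⟨ht.1, le_rfl⟩
    by_cases hba : b = a
    · subst hba
      exact ahit s (hs.2.trans_lt ht.2).ne
    · exact far b hb hba s ⟨hs.1, hs.2.trans (ht.2.le.trans hτ.2)⟩ _ (hut s hs.1.le)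
  have hXlow : ∀ t ∈ Icc 0 τ, X t = u * t := fun t ht => by
    rw [E.piston_position t ht.1, (integral_eq_of_eqOn_Ico ht.1 fun r hr =>
      hW r ⟨hr.1, hr.2.trans_le ht.2⟩).2, sub_zero]
  have hwa : ∀ t ∈ Ico 0 τ, w a t = a.2 := by
    intro t ht
    refine (E.atom_free_flight (T := t) ha (fun s hs => ?_) t ⟨ht.1, le_rfl⟩).1
    rw [hXlow s ⟨hs.1.le, hs.2.trans ht.2.le⟩]
    exact ahit s (hs.2.trans_lt ht.2).ne
  have hyτ : y a τ = X τ := by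
    rw [E.atom_position a ha τ hτ.1.le, (integral_eq_of_eqOn_Ico hτ.1.le hwa).2,
      hXlow τ ⟨hτ.1.le, le_rfl⟩, sub_zero, hhit]
  have hIoo : ∀ᶠ s in 𝓝[<] τ, s ∈ Ioo 0 τ := Ioo_mem_nhdsLT hτ.1
  obtain ⟨hWτ, hwτ⟩ := E.collision a ha τ hτ.1 hyτ u a.2
    (hIoo.mono fun s hs => hW s ⟨hs.1.le, hs.2⟩) (hIoo.mono fun s hs => hwa s ⟨hs.1.le, hs.2⟩)
  refine E.piston_step.eq_const_of_free hτ.1.le (T := T) hWτ (fun t ht htT hr => ?_) T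
    ⟨hτ.2, le_rfl⟩
  refine E.piston_free t (hτ.1.trans ht) fun b hb => ?_
  have hX : ∀ s ∈ Icc τ t, X s = u * τ + V' * (s - τ) := fun s hs => by
    rw [E.piston_position s (hτ.1.le.trans hs.1)]
    exact integral_eq_of_two_values hτ.1.le hs.1 hW fun r hr' => hr r ⟨hr'.1, hr'.2.trans_le hs.2⟩
  by_cases hba : b = a
  · subst hba
    have hyb : ∀ s ∈ Icc τ t, (∀ r ∈ Ico τ s, w b r = v') →
        y b s = b.1 + (b.2 * τ + v' * (s - τ)) := fun s hs hr' => by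
      rw [E.atom_position b hb s (hτ.1.le.trans hs.1),
        integral_eq_of_two_values hτ.1.le hs.1 hwa hr']
    have hne : ∀ s ∈ Ioc τ t, (∀ r ∈ Ico τ s, w b r = v') → y b s ≠ X s := by
      intro s hs hr' heq
      rw [hyb s ⟨hs.1.le, hs.2⟩ hr', hX s ⟨hs.1.le, hs.2⟩] at heq
      have : (v' - V') * (s - τ) = 0 := by linarith
      rcases mul_eq_zero.1 this with h | h
      · exact hsep (by linarith)
      · exact hs.1.ne (by linarith)
    have hw' := (E.atom_step b hb).eq_const_of_free hτ.1.le (T := t) hwτ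
      fun s hs hst hr' => E.atom_free b hb s (hτ.1.trans hs) (hne s ⟨hs, hst⟩ hr')
    exact hne t ⟨ht, le_rfl⟩ fun r hr' => hw' r ⟨hr'.1, hr'.2.le⟩
  · have hfree : ∀ s ∈ Ioc 0 t, b.1 + b.2 * s ≠ X s := by
      intro s hs
      refine far b hb hba s ⟨hs.1, hs.2.trans htT⟩ _ ?_
      rcases le_total s τ with hsτ | hsτ
      · rw [hXlow s ⟨hs.1.le, hsτ⟩]
        exact hut s hs.1.le
      · rw [hX s ⟨hsτ, hs.2⟩]
        refine (abs_add_le _ _).trans ?_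
        have h1 := hut τ hτ.1.le
        have h2 : |V' * (s - τ)| ≤ Vbar * (s - τ) := by
          rw [abs_mul, abs_of_nonneg (sub_nonneg.2 hsτ)]
          exact mul_le_mul_of_nonneg_right hbd (sub_nonneg.2 hsτ)
        linarith
    rw [(E.atom_free_flight hb hfree t ⟨(hτ.1.trans ht).le, le_rfl⟩).2]
    exact hfree t ⟨hτ.1.trans ht, le_rfl⟩

end Evolution

end Piston

namespace Piston

/-! ### Expectations in a Poisson process up to second order in the intensity -/

/-- The unique point of `ξ ω` in `D`, if there is exactly one. -/
noncomputable def uniquePoint {Ω E : Type*} [Inhabited E] (ξ : Ω → Set E) (D : Set E) (ω : Ω) : E :=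
  open Classical in if h : ∃ a, ξ ω ∩ D = {a} then h.choose else default

lemma uniquePoint_eq {Ω E : Type*} [Inhabited E] {ξ : Ω → Set E} {D : Set E} {ω : Ω} {a : E}
    (h : ξ ω ∩ D = {a}) : uniquePoint ξ D ω = a := by
  have hex : ∃ a, ξ ω ∩ D = {a} := ⟨a, h⟩
  rw [uniquePoint, dif_pos hex]
  exact (singleton_injective (h.symm.trans hex.choose_spec)).symm

namespace IsPoissonProcess

variable {Ω E : Type*} [MeasurableSpace Ω] [MeasurableSpace E] {P : Measure Ω}
  {ξ : Ω → Set E} {ν : Measure E} {D : Set E}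

lemma prob_count_zero (hξ : IsPoissonProcess P ξ ν) (hD : MeasurableSet D) (hν : ν D ≠ ∞) :
    P {ω | (ξ ω ∩ D).encard = 0} = ENNReal.ofReal (Real.exp (-(ν D).toReal)) := by
  have := hξ.count_law D hD hν 0
  rw [poissonMeasure_singleton] at this
  simpa [ENNReal.coe_toNNReal_eq_toReal] using this

lemma prob_count_one (hξ : IsPoissonProcess P ξ ν) (hD : MeasurableSet D) (hν : ν D ≠ ∞) :
    P {ω | (ξ ω ∩ D).encard = 1} = ENNReal.ofReal (Real.exp (-(ν D).toReal)) * ν D := by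
  have := hξ.count_law D hD hν 1
  rw [poissonMeasure_singleton] at this
  simp only [Nat.cast_one, pow_one, Nat.factorial_one, div_one] at this
  rw [this, ENNReal.ofReal_mul (Real.exp_pos _).le]
  simp [ENNReal.coe_toNNReal_eq_toReal, ENNReal.ofReal_toReal hν]

lemma ae_inter_eq_empty (hξ : IsPoissonProcess P ξ ν) [IsProbabilityMeasure P]
    (hD : MeasurableSet D) (hν : ν D = 0) : ∀ᵐ ω ∂P, ξ ω ∩ D = ∅ := by
  have h := hξ.prob_count_zero hD (by simp [hν])
  simp only [hν, ENNReal.toReal_zero, neg_zero, Real.exp_zero, ENNReal.ofReal_one] at h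
  have hm : MeasurableSet {ω | (ξ ω ∩ D).encard = 0} :=
    hξ.measurable_count D hD (measurableSet_singleton 0)
  filter_upwards [(mem_ae_iff_prob_eq_one hm).2 h] with ω hω
  exact encard_eq_zero.1 hω

/-- The counts in `A` and `D \ A` are independent, and the two exponential factors combine to exp(-ν
D) by additivity of ν. -/
lemma prob_count_one_count_zero (hξ : IsPoissonProcess P ξ ν) {A : Set E}
    (hD : MeasurableSet D) (hν : ν D ≠ ∞) (hA : MeasurableSet A) (hAD : A ⊆ D) :
    P {ω | (ξ ω ∩ A).encard = 1 ∧ (ξ ω ∩ (D \ A)).encard = 0} =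
      ENNReal.ofReal (Real.exp (-(ν D).toReal)) * ν A := by
  have hνA : ν A ≠ ∞ := ne_top_of_le_ne_top hν (measure_mono hAD)
  have hνDA : ν (D \ A) ≠ ∞ := ne_top_of_le_ne_top hν (measure_mono sdiff_subset)
  have hind := hξ.indep 2 ![A, D \ A] (by intro i; fin_cases i <;> simp [hA, hD.diff hA])
    (by
      intro i j hij
      fin_cases i <;> fin_cases j <;> simp_all [Function.onFun, disjoint_sdiff_left,
        disjoint_sdiff_right])
  have hind' : IndepFun (fun ω => (ξ ω ∩ A).encard) (fun ω => (ξ ω ∩ (D \ A)).encard) P := by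
    simpa using hind.indepFun (i := 0) (j := 1) (by decide)
  have := hind'.measure_inter_preimage_eq_mul {1} {0} (measurableSet_singleton _)
    (measurableSet_singleton _)
  have e : {ω | (ξ ω ∩ A).encard = 1 ∧ (ξ ω ∩ (D \ A)).encard = 0} =
      (fun ω => (ξ ω ∩ A).encard) ⁻¹' {1} ∩ (fun ω => (ξ ω ∩ (D \ A)).encard) ⁻¹' {0} := rfl
  rw [e, this]
  change P {ω | (ξ ω ∩ A).encard = 1} * P {ω | (ξ ω ∩ (D \ A)).encard = 0} = _
  rw [hξ.prob_count_one hA hνA, hξ.prob_count_zero (hD.diff hA) hνDA, mul_right_comm,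
    ← ENNReal.ofReal_mul (Real.exp_pos _).le, ← Real.exp_add]
  congr 3
  rw [← measure_inter_add_sdiff D hA, inter_eq_right.2 hAD, ENNReal.toReal_add hνA hνDA]
  ring_nf

/-- Only counts are known to be measurable, so the preimage of `A` is expressed by the counts in `D`
and `D ∩ A`; where the count in `D` is not one, the point is `default`. -/
lemma measurable_uniquePoint [Inhabited E] (hξ : IsPoissonProcess P ξ ν)
    (hD : MeasurableSet D) : Measurable (uniquePoint ξ D) := by
  intro A hA
  have h1 : MeasurableSet {ω | (ξ ω ∩ D).encard = 1} :=
    hξ.measurable_count D hD (measurableSet_singleton 1)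
  have h2 : MeasurableSet {ω | (ξ ω ∩ (D ∩ A)).encard = 1} :=
    hξ.measurable_count _ (hD.inter hA) (measurableSet_singleton 1)
  have e : uniquePoint ξ D ⁻¹' A =
      ({ω | (ξ ω ∩ D).encard = 1} ∩ {ω | (ξ ω ∩ (D ∩ A)).encard = 1}) ∪
        ({ω | (ξ ω ∩ D).encard = 1}ᶜ ∩ {_ω | default ∈ A}) := by
    ext ω
    by_cases h : ∃ a, ξ ω ∩ D = {a}
    · obtain ⟨a, ha⟩ := h
      simp only [mem_preimage, uniquePoint_eq ha, mem_union, mem_inter_iff, mem_ofPred_eq,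
        mem_compl_iff, ha, ← inter_assoc, encard_singleton, not_true, false_and, or_false, true_and]
      by_cases haA : a ∈ A
      · simp [haA]
      · simp [haA]
    · have h' : ¬ (ξ ω ∩ D).encard = 1 := by rwa [encard_eq_one]
      simp [uniquePoint, dif_neg h, h']
  rw [e]
  exact (h1.inter h2).union (h1.compl.inter (MeasurableSet.const _))

/-- The only point in `D` lies in `A` exactly when `D ∩ A` holds one point and the rest of `D` none.
-/
lemma map_uniquePoint [Inhabited E] (hξ : IsPoissonProcess P ξ ν)
    (hD : MeasurableSet D) (hν : ν D ≠ ∞) :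
    (P.restrict {ω | (ξ ω ∩ D).encard = 1}).map (uniquePoint ξ D) =
      ENNReal.ofReal (Real.exp (-(ν D).toReal)) • ν.restrict D := by
  ext A hA
  have hm := hξ.measurable_uniquePoint hD
  rw [Measure.map_apply hm hA, Measure.restrict_apply (hm hA), Measure.smul_apply,
    Measure.restrict_apply hA, smul_eq_mul, inter_comm A D,
    ← hξ.prob_count_one_count_zero hD hν (hD.inter hA) inter_subset_left]
  congr 1
  ext ω
  simp only [mem_inter_iff, mem_preimage, mem_ofPred_eq]
  constructor
  · rintro ⟨h1, h2⟩
    obtain ⟨a, ha⟩ := encard_eq_one.1 h2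
    rw [uniquePoint_eq ha] at h1
    rw [sdiff_self_inter, ← inter_assoc, ← inter_sdiff_assoc, ha,
      sdiff_eq_empty.2 (singleton_subset_iff.2 h1)]
    simp [h1]
  · rintro ⟨h1, h2⟩
    obtain ⟨a, ha⟩ := encard_eq_one.1 h1
    have haD : ξ ω ∩ D = {a} := by
      rw [← ha, ← inter_union_sdiff D A, inter_union_distrib_left]
      rw [sdiff_self_inter, encard_eq_zero] at h2
      rw [h2, union_empty, inter_union_sdiff]
    rw [uniquePoint_eq haD, haD]
    have : a ∈ ξ ω ∩ (D ∩ A) := ha ▸ mem_singleton a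
    exact ⟨this.2.2, encard_singleton a⟩

/-- Expansion of an expectation in terms of the first order of the intensity. -/
lemma abs_integral_sub_le [Inhabited E] (hξ : IsPoissonProcess P ξ ν) [IsProbabilityMeasure P]
    (hD : MeasurableSet D) (hν : ν D ≠ ∞) {Y : Ω → ℝ} {g : E → ℝ} {c B : ℝ}
    (hY : AEStronglyMeasurable Y P) (hYB : ∀ ω, |Y ω| ≤ B) (hg : Measurable g)
    (hgB : ∀ a, |g a| ≤ B) (hc : |c| ≤ B) (h0 : ∀ᵐ ω ∂P, ξ ω ∩ D = ∅ → Y ω = c)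
    (h1 : ∀ᵐ ω ∂P, ∀ a, ξ ω ∩ D = {a} → Y ω = g a) :
    |(∫ ω, Y ω ∂P) - c - ∫ a in D, (g a - c) ∂ν| ≤ 4 * B * (ν D).toReal ^ 2 := by
  set l := (ν D).toReal with hl
  set S₀ := {ω | (ξ ω ∩ D).encard = 0}
  set S₁ := {ω | (ξ ω ∩ D).encard = 1}
  have hS₀ : MeasurableSet S₀ := hξ.measurable_count D hD (measurableSet_singleton 0)
  have hS₁ : MeasurableSet S₁ := hξ.measurable_count D hD (measurableSet_singleton 1)
  have hdisj : Disjoint S₀ S₁ := by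
    rw [Set.disjoint_left]
    intro ω h h'
    have h2 : (0 : ℕ∞) = 1 := (show (ξ ω ∩ D).encard = 0 from h).symm.trans h'
    exact zero_ne_one h2
  have hl0 : 0 ≤ l := ENNReal.toReal_nonneg
  have hP₀ : P.real S₀ = Real.exp (-l) := by
    rw [Measure.real, hξ.prob_count_zero hD hν, ENNReal.toReal_ofReal (Real.exp_pos _).le]
  have hP₁ : P.real S₁ = Real.exp (-l) * l := by
    rw [Measure.real, hξ.prob_count_one hD hν, ENNReal.toReal_mul,
      ENNReal.toReal_ofReal (Real.exp_pos _).le]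
  have hB : 0 ≤ B := (abs_nonneg _).trans hc
  have hYi : Integrable Y P := .of_bound hY B (.of_forall fun ω => by simpa using hYB ω)
  have I₀ : ∫ ω in S₀, Y ω ∂P = Real.exp (-l) * c := by
    rw [setIntegral_congr_ae hS₀ (g := fun _ => c) (h0.mono fun ω h hω => h (encard_eq_zero.1 hω)),
      setIntegral_const, hP₀, smul_eq_mul]
  have : IsFiniteMeasure (ν.restrict D) := ⟨by simpa using hν.lt_top⟩
  have hgi : Integrable g (ν.restrict D) :=
    .of_bound hg.aestronglyMeasurable B (.of_forall fun a => by simpa using hgB a)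
  set J := ∫ a in D, (g a - c) ∂ν with hJ
  have hJg : ∫ a in D, g a ∂ν = J + c * l := by
    rw [hJ, integral_sub hgi (integrable_const _), setIntegral_const, Measure.real, smul_eq_mul,
      ← hl]
    ring
  have I₁ : ∫ ω in S₁, Y ω ∂P = Real.exp (-l) * (J + c * l) := by
    have hm := hξ.measurable_uniquePoint hD
    rw [setIntegral_congr_ae hS₁ (g := fun ω => g (uniquePoint ξ D ω)) (h1.mono fun ω h hω => by
      obtain ⟨a, ha⟩ := encard_eq_one.1 hω
      rw [uniquePoint_eq ha]
      exact h a ha), ← hJg,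
      ← integral_map (f := g) hm.aemeasurable hg.aestronglyMeasurable, hξ.map_uniquePoint hD hν,
      integral_smul_measure, ENNReal.toReal_ofReal (Real.exp_pos _).le, smul_eq_mul]
  have hexp : 1 - l ≤ Real.exp (-l) := by linarith [Real.add_one_le_exp (-l)]
  have hexp1 : Real.exp (-l) ≤ 1 := Real.exp_le_one_iff.2 (by linarith)
  have hcompl : P.real (S₀ ∪ S₁)ᶜ = 1 - Real.exp (-l) * (1 + l) := by
    rw [probReal_compl_eq_one_sub (hS₀.union hS₁), measureReal_union hdisj hS₁, hP₀, hP₁]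
    ring
  -- The probability of two or more points is of second order, by exp(-l) ≥ 1 - l.
  have hq : 1 - Real.exp (-l) * (1 + l) ≤ l ^ 2 := by
    nlinarith [mul_le_mul_of_nonneg_right hexp (by linarith : 0 ≤ 1 + l)]
  have hq0 : 0 ≤ 1 - Real.exp (-l) * (1 + l) := hcompl ▸ measureReal_nonneg
  have hR : |∫ ω in (S₀ ∪ S₁)ᶜ, Y ω ∂P| ≤ B * l ^ 2 := by
    refine (norm_setIntegral_le_of_norm_le_const (measure_lt_top _ _) fun ω _ =>
      (by simpa using hYB ω : ‖Y ω‖ ≤ B)).trans ?_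
    rw [hcompl]
    gcongr
  have hJB : |J| ≤ 2 * B * l := by
    refine (norm_setIntegral_le_of_norm_le_const (f := fun a => g a - c) (C := 2 * B) hν.lt_top
      fun a _ => ?_).trans ?_
    · exact (abs_sub _ _).trans (by linarith [hgB a])
    · rw [Measure.real]
  have hsplit : ∫ ω, Y ω ∂P = Real.exp (-l) * c + Real.exp (-l) * (J + c * l) +
      ∫ ω in (S₀ ∪ S₁)ᶜ, Y ω ∂P := by
    rw [← integral_add_compl (hS₀.union hS₁) hYi,
      setIntegral_union hdisj hS₁ hYi.integrableOn hYi.integrableOn, I₀, I₁]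
  rw [hsplit]
  set R := ∫ ω in (S₀ ∪ S₁)ᶜ, Y ω ∂P
  -- The three errors are at most `B * l ^ 2`, `B * l ^ 2` and `2 * B * l ^ 2`, whence the constant
  -- 4.
  have e : Real.exp (-l) * c + Real.exp (-l) * (J + c * l) + R - c - J =
      R - c * (1 - Real.exp (-l) * (1 + l)) - J * (1 - Real.exp (-l)) := by ring
  rw [e]
  refine (abs_sub _ _).trans ((add_le_add_left (abs_sub _ _) _).trans ?_)
  rw [abs_mul, abs_mul, abs_of_nonneg hq0, abs_of_nonneg (by linarith : 0 ≤ 1 - Real.exp (-l))]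
  have t1 : |c| * (1 - Real.exp (-l) * (1 + l)) ≤ B * l ^ 2 := mul_le_mul hc hq hq0 hB
  have t2 : |J| * (1 - Real.exp (-l)) ≤ 2 * B * l * l :=
    mul_le_mul hJB (by linarith) (by linarith) (by positivity)
  nlinarith

end IsPoissonProcess

end Piston

namespace Piston

/-! ### The generator of the velocity process -/

/-- `η = 2m/(M+m)` is so small, compared to the velocity cutoffs, that an atom hits the piston at
most once and that the reflection keeps the piston velocity in `[-Vbar, Vbar]`. -/
structure IsHeavy (vmin vmax Vbar η : ℝ) : Prop where
  vmin_pos : 0 < vmin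
  vmin_lt : vmin < vmax
  Vbar_pos : 0 < Vbar
  pos : 0 < η
  no_recollision : 3 * Vbar < (1 - η) * vmin
  small_kick : η * (vmax + Vbar) ≤ Vbar / 2

/-- The velocity of the piston after it is hit, with velocity `u`, by an atom of velocity `v`. -/
noncomputable def kick (Vbar η u v : ℝ) : ℝ := reflect Vbar (u + η * (v - u))

/-- `p_-` on the right half line and `-p_+` on the left half line. -/
noncomputable def signedDensity (pminus pplus : ℝ → ℝ) (v : ℝ) : ℝ :=
  if 0 < v then pminus v else -pplus v

/-- The generator of the velocity process, for `|u| ≤ Vbar`: the atoms of velocity `v` hit the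
piston at rate `(v - u) * signedDensity pminus pplus v`. -/
noncomputable def generator (Vbar η : ℝ) (pminus pplus f : ℝ → ℝ) (u : ℝ) : ℝ :=
  ∫ v, (v - u) * signedDensity pminus pplus v * (f (kick Vbar η u v) - f u)

/-- The atoms that hit, during `(0, h]`, a piston of constant velocity `u`. -/
def hitSet (u h : ℝ) : Set (ℝ × ℝ) :=
  {a | (-(h * (a.2 - u)) ≤ a.1 ∧ a.1 < 0) ∨ (0 < a.1 ∧ a.1 ≤ h * (u - a.2))}

/-- The strip of half-width `r` around the piston. -/
def slab (r : ℝ) : Set (ℝ × ℝ) := {a | |a.1| ≤ r}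

lemma measurableSet_hitSet (u h : ℝ) : MeasurableSet (hitSet u h) := by
  unfold hitSet
  measurability

lemma measurableSet_slab (r : ℝ) : MeasurableSet (slab r) :=
  measurableSet_le (by fun_prop) (by fun_prop)

lemma measurable_reflect (Vbar : ℝ) : Measurable (reflect Vbar) :=
  Measurable.ite measurableSet_Ioi (by fun_prop)
    (Measurable.ite measurableSet_Iio (by fun_prop) (by fun_prop))

lemma measurable_kick (Vbar η : ℝ) : Measurable fun z : ℝ × ℝ => kick Vbar η z.1 z.2 :=
  (measurable_reflect Vbar).comp (by fun_prop)

lemma pistonAfter_eq {m M : ℝ} (h : M + m ≠ 0) (V v : ℝ) :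
    pistonAfter m M V v = V + 2 * m / (M + m) * (v - V) := by
  unfold pistonAfter
  field_simp
  ring

lemma atomAfter_eq {m M : ℝ} (h : M + m ≠ 0) (V v : ℝ) :
    atomAfter m M V v = -(1 - 2 * m / (M + m)) * v + (2 - 2 * m / (M + m)) * V := by
  unfold atomAfter
  field_simp
  ring

lemma abs_reflect_le {Vbar V : ℝ} (h : |V| ≤ 3 * Vbar) : |reflect Vbar V| ≤ Vbar := by
  rw [abs_le] at h ⊢
  unfold reflect
  split_ifs <;> constructor <;> linarith

lemma exists_hit_iff {u h : ℝ} (hh : 0 < h) {a : ℝ × ℝ} (hau : a.2 ≠ u) :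
    (∃ t ∈ Ioc 0 h, a.1 + a.2 * t = u * t) ↔ a ∈ hitSet u h := by
  constructor
  · rintro ⟨t, ⟨ht0, hth⟩, ht⟩
    rcases lt_or_gt_of_ne hau with hlt | hlt
    · exact Or.inr ⟨by nlinarith, by nlinarith⟩
    · exact Or.inl ⟨by nlinarith, by nlinarith⟩
  · rintro (⟨h1, h2⟩ | ⟨h1, h2⟩)
    · have hlt : 0 < a.2 - u := pos_of_mul_pos_right (by linarith : 0 < h * (a.2 - u)) hh.le
      refine ⟨-a.1 / (a.2 - u), ⟨div_pos (by linarith) hlt, ?_⟩, by field_simp; ring⟩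
      rw [div_le_iff₀ hlt]
      linarith
    · have hlt : 0 < u - a.2 := pos_of_mul_pos_right (by linarith : 0 < h * (u - a.2)) hh.le
      refine ⟨a.1 / (u - a.2), ⟨div_pos (by linarith) hlt, ?_⟩, by field_simp; ring⟩
      rwa [div_le_iff₀ hlt]

section Gas

variable {vmin vmax : ℝ} {pminus pplus : ℝ → ℝ}

lemma measurable_signedDensity (hm : Measurable pminus) (hp : Measurable pplus) :
    Measurable (signedDensity pminus pplus) :=
  Measurable.ite measurableSet_Ioi hm hp.neg

lemma abs_signedDensity_le (hm : IsGasDensity vmin vmax pminus) (hp : IsGasDensity vmin vmax pplus)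
    (v : ℝ) : |signedDensity pminus pplus v| ≤ pminus v + pplus v := by
  have h1 := hm.nonneg v
  have h2 := hp.nonneg v
  unfold signedDensity
  split_ifs
  · rw [abs_of_nonneg h1]; linarith
  · rw [abs_neg, abs_of_nonneg h2]; linarith

lemma signedDensity_eq_zero (hm : IsGasDensity vmin vmax pminus)
    (hp : IsGasDensity vmin vmax pplus) {v : ℝ} (hv : |v| ≤ vmin ∨ vmax ≤ |v|) :
    signedDensity pminus pplus v = 0 := by
  simp [signedDensity, hm.cutoff v hv, hp.cutoff v hv]

lemma measurable_gasDensity (hm : Measurable pminus) (hp : Measurable pplus) :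
    Measurable fun a : ℝ × ℝ => if a.1 < 0 then pminus a.2 else pplus a.2 :=
  Measurable.ite (measurableSet_lt (by fun_prop) (by fun_prop)) (hm.comp measurable_snd)
    (hp.comp measurable_snd)

lemma gasIntensity_cutoff (hm : IsGasDensity vmin vmax pminus)
    (hp : IsGasDensity vmin vmax pplus) :
    MeasurableSet {a : ℝ × ℝ | |a.2| ≤ vmin ∨ vmax ≤ |a.2|} ∧
    gasIntensity pminus pplus {a | |a.2| ≤ vmin ∨ vmax ≤ |a.2|} = 0 := by
  have hS : MeasurableSet {a : ℝ × ℝ | |a.2| ≤ vmin ∨ vmax ≤ |a.2|} :=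
    (measurableSet_le (f := fun a : ℝ × ℝ => |a.2|) (g := fun _ => vmin)
      (by fun_prop) (by fun_prop)).union
      (measurableSet_le (f := fun _ => vmax) (g := fun a : ℝ × ℝ => |a.2|)
        (by fun_prop) (by fun_prop))
  refine ⟨hS, ?_⟩
  rw [gasIntensity, withDensity_apply _ hS]
  refine (setLIntegral_congr_fun hS (g := fun _ => 0) fun a ha => ?_).trans (by simp)
  simp [hm.cutoff a.2 ha, hp.cutoff a.2 ha]

lemma gasIntensity_slab_le (hm : IsGasDensity vmin vmax pminus)
    (hp : IsGasDensity vmin vmax pplus) (r : ℝ) :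
    gasIntensity pminus pplus (slab r) ≤
      ENNReal.ofReal (2 * r * ∫ v, (pminus v + pplus v)) := by
  have hi : Integrable fun v => pminus v + pplus v := hm.integrable.add hp.integrable
  have h0 : ∀ v, 0 ≤ pminus v + pplus v := fun v => add_nonneg (hm.nonneg v) (hp.nonneg v)
  rw [gasIntensity, withDensity_apply _ (measurableSet_slab r)]
  have e : slab r = Icc (-r) r ×ˢ univ := by
    ext a
    simp [slab, abs_le]
  have hmeas : Measurable fun a : ℝ × ℝ => ENNReal.ofReal (pminus a.2 + pplus a.2) :=
    ((hm.measurable.add hp.measurable).comp measurable_snd).ennreal_ofReal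
  calc ∫⁻ a in slab r, ENNReal.ofReal (if a.1 < 0 then pminus a.2 else pplus a.2)
      ≤ ∫⁻ a in slab r, ENNReal.ofReal (pminus a.2 + pplus a.2) := by
        refine lintegral_mono fun a => ENNReal.ofReal_le_ofReal ?_
        split_ifs
        · linarith [hp.nonneg a.2]
        · linarith [hm.nonneg a.2]
    _ = ENNReal.ofReal (2 * r * ∫ v, (pminus v + pplus v)) := by
        rw [e, Measure.volume_eq_prod, ← Measure.prod_restrict, Measure.restrict_univ,
          lintegral_prod _ hmeas.aemeasurable]
        simp only [lintegral_const, Measure.restrict_apply_univ, Real.volume_Icc]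
        rw [← ofReal_integral_eq_lintegral_ofReal hi (.of_forall h0),
          ← ENNReal.ofReal_mul (integral_nonneg h0)]
        congr 1
        ring

/-- Where the density is nonzero, |v| > vmin > |u|, so atoms of velocity `v` reach the piston only
from the side given by the sign of `v`. Their starting points fill an interval of length h|v - u|
inside the slab; the sign in `signedDensity` turns |v - u| into `v - u`. -/
lemma integral_indicator_hit (hm : IsGasDensity vmin vmax pminus)
    (hp : IsGasDensity vmin vmax pplus) {Vbar u h c : ℝ} (hvmin : 0 < vmin) (hVbar : Vbar < vmin)
    (hu : |u| ≤ Vbar) (hh : 0 < h) (v : ℝ) :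
    ∫ x, (slab ((vmax + Vbar) * h) ∩ hitSet u h).indicator
      (fun a => (if a.1 < 0 then pminus a.2 else pplus a.2) * c) (x, v) =
      h * ((v - u) * signedDensity pminus pplus v * c) := by
  by_cases hv : |v| ≤ vmin ∨ vmax ≤ |v|
  · simp [signedDensity_eq_zero hm hp hv, hm.cutoff v hv, hp.cutoff v hv, indicator]
  push Not at hv
  obtain ⟨hv1, hv2⟩ := hv
  rw [abs_le] at hu
  rw [abs_lt] at hv2
  rcases lt_abs.1 hv1 with hpos | hneg
  · have e : ∀ x, (slab ((vmax + Vbar) * h) ∩ hitSet u h).indicator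
        (fun a => (if a.1 < 0 then pminus a.2 else pplus a.2) * c) (x, v) =
        (Ico (-(h * (v - u))) 0).indicator (fun _ => pminus v * c) x := by
      intro x
      by_cases hx : x ∈ Ico (-(h * (v - u))) 0
      · rw [indicator_of_mem hx, indicator_of_mem]
        · simp [hx.2]
        · refine ⟨?_, Or.inl hx⟩
          change |x| ≤ _
          rw [abs_of_neg hx.2]
          nlinarith [hx.1]
      · rw [indicator_of_notMem hx, indicator_of_notMem]
        rintro ⟨-, h1 | ⟨h1, h2⟩⟩
        · exact hx h1
        · simp only at h1 h2
          nlinarith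
    simp_rw [e]
    rw [integral_indicator measurableSet_Ico, setIntegral_const, Real.volume_real_Ico_of_le
      (by nlinarith), signedDensity, if_pos (by linarith), smul_eq_mul]
    ring
  · have e : ∀ x, (slab ((vmax + Vbar) * h) ∩ hitSet u h).indicator
        (fun a => (if a.1 < 0 then pminus a.2 else pplus a.2) * c) (x, v) =
        (Ioc 0 (h * (u - v))).indicator (fun _ => pplus v * c) x := by
      intro x
      by_cases hx : x ∈ Ioc 0 (h * (u - v))
      · rw [indicator_of_mem hx, indicator_of_mem]
        · simp [hx.1.le]
        · refine ⟨?_, Or.inr hx⟩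
          change |x| ≤ _
          rw [abs_of_pos hx.1]
          nlinarith [hx.2]
      · rw [indicator_of_notMem hx, indicator_of_notMem]
        rintro ⟨-, ⟨h1, h2⟩ | h1⟩
        · simp only at h1 h2
          nlinarith
        · exact hx h1
    simp_rw [e]
    rw [integral_indicator measurableSet_Ioc, setIntegral_const, Real.volume_real_Ioc_of_le
      (by nlinarith), signedDensity, if_neg (by linarith), smul_eq_mul]
    ring

lemma setIntegral_hit (hm : IsGasDensity vmin vmax pminus) (hp : IsGasDensity vmin vmax pplus)
    {Vbar u h B : ℝ} (hvmin : 0 < vmin) (hVbar : Vbar < vmin) (hu : |u| ≤ Vbar) (hh : 0 < h)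
    {φ : ℝ → ℝ} (hφ : Measurable φ) (hφB : ∀ v, |φ v| ≤ B) :
    ∫ a in slab ((vmax + Vbar) * h), (hitSet u h).indicator (fun a => φ a.2) a
        ∂gasIntensity pminus pplus =
      h * ∫ v, (v - u) * signedDensity pminus pplus v * φ v := by
  have hD := measurableSet_slab ((vmax + Vbar) * h)
  have hH := measurableSet_hitSet u h
  have hdens := measurable_gasDensity hm.measurable hp.measurable
  have hdens0 : ∀ a : ℝ × ℝ, 0 ≤ (if a.1 < 0 then pminus a.2 else pplus a.2) := fun a => by
    split_ifs
    · exact hm.nonneg _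
    · exact hp.nonneg _
  set G : ℝ × ℝ → ℝ := (slab ((vmax + Vbar) * h) ∩ hitSet u h).indicator
    (fun a => (if a.1 < 0 then pminus a.2 else pplus a.2) * φ a.2) with hG
  have hGm : Measurable G := (hdens.mul (hφ.comp measurable_snd)).indicator (hD.inter hH)
  have hB : 0 ≤ B := (abs_nonneg _).trans (hφB 0)
  have hGi : Integrable G (volume.prod volume) := by
    have h1 : Integrable ((Icc (-((vmax + Vbar) * h)) ((vmax + Vbar) * h)).indicator
        fun _ : ℝ => (1 : ℝ)) := (integrableOn_const (by simp) (by simp)).integrable_indicator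
          measurableSet_Icc
    have h2 : Integrable fun v => (pminus v + pplus v) * B :=
      (hm.integrable.add hp.integrable).mul_const B
    refine (h1.mul_prod h2).mono' hGm.aestronglyMeasurable (.of_forall fun a => ?_)
    by_cases ha : a ∈ slab ((vmax + Vbar) * h) ∩ hitSet u h
    · have ha1 : a.1 ∈ Icc (-((vmax + Vbar) * h)) ((vmax + Vbar) * h) := abs_le.1 ha.1
      rw [hG, indicator_of_mem ha, indicator_of_mem ha1, one_mul, norm_mul, Real.norm_eq_abs,
        Real.norm_eq_abs, abs_of_nonneg (hdens0 a)]
      refine mul_le_mul ?_ (hφB _) (abs_nonneg _) (add_nonneg (hm.nonneg _) (hp.nonneg _))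
      split_ifs
      · linarith [hp.nonneg a.2]
      · linarith [hm.nonneg a.2]
    · rw [hG, indicator_of_notMem ha, norm_zero]
      exact mul_nonneg (indicator_nonneg (by simp) _)
        (mul_nonneg (add_nonneg (hm.nonneg _) (hp.nonneg _)) hB)
  rw [gasIntensity, setIntegral_withDensity_eq_setIntegral_toReal_smul hdens.ennreal_ofReal
    (.of_forall fun a => ENNReal.ofReal_lt_top) _ hD, ← integral_indicator hD]
  have e : (slab ((vmax + Vbar) * h)).indicator (fun a : ℝ × ℝ =>
      (ENNReal.ofReal (if a.1 < 0 then pminus a.2 else pplus a.2)).toReal •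
        (hitSet u h).indicator (fun a => φ a.2) a) = G := by
    ext a
    by_cases h1 : a ∈ slab ((vmax + Vbar) * h) <;> by_cases h2 : a ∈ hitSet u h <;>
      simp [hG, h1, h2, hdens0 a]
  rw [e, Measure.volume_eq_prod, integral_prod_symm G hGi, ← integral_const_mul]
  refine integral_congr_ae (.of_forall fun v => ?_)
  exact integral_indicator_hit hm hp (c := φ v) hvmin hVbar hu hh v

end Gas

end Piston

namespace Piston

/-! ### Short-time expansion of the transition probability -/

namespace IsHeavy

variable {vmin vmax Vbar η : ℝ}

lemma Vbar_lt (H : IsHeavy vmin vmax Vbar η) : 3 * Vbar < vmin := by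
  nlinarith [H.no_recollision, mul_pos H.pos H.vmin_pos]

lemma abs_kick_le (H : IsHeavy vmin vmax Vbar η) {u v : ℝ} (hu : |u| ≤ Vbar) (hv : |v| ≤ vmax) :
    |η * (v - u)| ≤ Vbar / 2 := by
  rw [abs_mul, abs_of_pos H.pos]
  refine le_trans ?_ H.small_kick
  have := abs_sub v u
  exact mul_le_mul_of_nonneg_left (by linarith) H.pos.le

lemma abs_kick_result_le (H : IsHeavy vmin vmax Vbar η) {u v : ℝ} (hu : |u| ≤ Vbar)
    (hv : |v| ≤ vmax) : |kick Vbar η u v| ≤ Vbar := by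
  refine abs_reflect_le ((abs_add_le _ _).trans ?_)
  linarith [H.abs_kick_le hu hv, H.Vbar_pos]

/-- The outgoing atom has speed above 3Vbar - (2 - η)Vbar > Vbar, by `no_recollision`, whereas the
piston stays within Vbar. -/
lemma atom_separates (H : IsHeavy vmin vmax Vbar η) {u v : ℝ} (hu : |u| ≤ Vbar)
    (hv : vmin < |v|) (hv' : |v| ≤ vmax) : -(1 - η) * v + (2 - η) * u ≠ kick Vbar η u v := by
  have hk := abs_le.1 (H.abs_kick_result_le hu hv')
  have hη1 : 0 < 1 - η := pos_of_mul_pos_left (by linarith [H.no_recollision, H.Vbar_pos])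
    H.vmin_pos.le
  have hu' := abs_le.1 hu
  have h1 := H.no_recollision
  have h2 := mul_pos H.pos H.Vbar_pos
  intro heq
  rcases lt_abs.1 hv with h | h
  · nlinarith [mul_lt_mul_of_pos_left h hη1]
  · nlinarith [mul_lt_mul_of_pos_left h hη1]

end IsHeavy

section ShortTime

variable {vmin vmax Vbar m M : ℝ} {pminus pplus : ℝ → ℝ}

/-- The first-order Poisson expansion is applied on the slab that contains every starting point from
which an atom could reach the piston by time `h`. Its measure is linear in `h`, so the error is
quadratic, uniformly in `u`. -/
lemma abs_integral_sub_generator_le (hm : IsGasDensity vmin vmax pminus)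
    (hp : IsGasDensity vmin vmax pplus) (hmM : M + m ≠ 0)
    (H : IsHeavy vmin vmax Vbar (2 * m / (M + m))) {u h B : ℝ} (hu : |u| ≤ Vbar) (hh : 0 < h)
    {f : ℝ → ℝ} (hf : Measurable f) (hfB : ∀ x, |f x| ≤ B)
    {Ω : Type*} [MeasurableSpace Ω] {P : Measure Ω} [IsProbabilityMeasure P]
    {ξ : Ω → Set (ℝ × ℝ)} {W : ℝ → Ω → ℝ}
    (hξ : IsPoissonProcess P ξ (gasIntensity pminus pplus)) (hW : AEMeasurable (W h) P)
    (hE : ∀ᵐ ω ∂P, ∃ (X : ℝ → ℝ) (y w : ℝ × ℝ → ℝ → ℝ),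
      Evolution m M Vbar u (ξ ω) X (fun t => W t ω) y w) :
    |(∫ ω, f (W h ω) ∂P) - f u - h * generator Vbar (2 * m / (M + m)) pminus pplus f u| ≤
      4 * B * (2 * (vmax + Vbar) * ∫ v, (pminus v + pplus v)) ^ 2 * h ^ 2 := by
  set η := 2 * m / (M + m) with hη
  have hB : 0 ≤ B := (abs_nonneg _).trans (hfB 0)
  have hVv := H.Vbar_lt
  have hVpos := H.Vbar_pos
  have hK : 0 < vmax + Vbar := by linarith [H.vmin_pos, H.vmin_lt]
  have hr : 0 ≤ (vmax + Vbar) * h := by positivity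
  set D := slab ((vmax + Vbar) * h) with hDdef
  set ν := gasIntensity pminus pplus with hνdef
  have hD : MeasurableSet D := measurableSet_slab _
  have hνle := gasIntensity_slab_le hm hp ((vmax + Vbar) * h)
  have hν : ν D ≠ ∞ := ne_top_of_le_ne_top ENNReal.ofReal_ne_top hνle
  have hI : 0 ≤ ∫ v, (pminus v + pplus v) :=
    integral_nonneg fun v => add_nonneg (hm.nonneg v) (hp.nonneg v)
  have hνr : (ν D).toReal ≤ 2 * (vmax + Vbar) * (∫ v, (pminus v + pplus v)) * h := by
    refine (ENNReal.toReal_mono ENNReal.ofReal_ne_top hνle).trans ?_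
    rw [ENNReal.toReal_ofReal (by positivity)]
    exact le_of_eq (by ring)
  set φ : ℝ → ℝ := fun v => f (kick Vbar η u v) - f u with hφ
  have hφm : Measurable φ := by
    refine (hf.comp ?_).sub_const _
    exact (measurable_kick Vbar η).comp (by fun_prop : Measurable fun v : ℝ => (u, v))
  have hφB : ∀ v, |φ v| ≤ 2 * B := fun v =>
    (abs_sub _ _).trans (by linarith [hfB (kick Vbar η u v), hfB u])
  -- The value of `f (W h)` when `a` is the only atom in the slab.
  set g : ℝ × ℝ → ℝ := fun a => f u + (hitSet u h).indicator (fun a => φ a.2) a with hg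
  have hgm : Measurable g :=
    measurable_const.add ((hφm.comp measurable_snd).indicator (measurableSet_hitSet u h))
  have hgmem : ∀ a ∈ hitSet u h, g a = f (kick Vbar η u a.2) := fun a ha => by
    simp [hg, hφ, indicator_of_mem ha]
  have hgnot : ∀ a ∉ hitSet u h, g a = f u := fun a ha => by simp [hg, indicator_of_notMem ha]
  have hgB : ∀ a, |g a| ≤ B := fun a => by
    by_cases ha : a ∈ hitSet u h
    · rw [hgmem a ha]; exact hfB _
    · rw [hgnot a ha]; exact hfB _
  obtain ⟨hZm, hZ⟩ := gasIntensity_cutoff hm hp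
  have hgood := hξ.ae_inter_eq_empty hZm hZ
  have hcut : ∀ ω, ξ ω ∩ {a | |a.2| ≤ vmin ∨ vmax ≤ |a.2|} = ∅ →
      ∀ a ∈ ξ ω, vmin < |a.2| ∧ |a.2| < vmax := by
    intro ω hω a ha
    by_contra hcon
    have hZa : |a.2| ≤ vmin ∨ vmax ≤ |a.2| := by
      by_contra! hc
      exact hcon hc
    exact (hω ▸ (⟨ha, hZa⟩ : a ∈ ξ ω ∩ {a | |a.2| ≤ vmin ∨ vmax ≤ |a.2|}) : a ∈ (∅ : Set (ℝ × ℝ)))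
  have hne : ∀ a : ℝ × ℝ, vmin < |a.2| → a.2 ≠ u := by
    rintro a ha rfl
    linarith
  have hfar : ∀ a : ℝ × ℝ, |a.2| < vmax → a ∉ D → ∀ t ∈ Ioc 0 h, a.1 + a.2 * t ≠ u * t := by
    intro a ha haD t ht heq
    apply haD
    change |a.1| ≤ (vmax + Vbar) * h
    rw [show a.1 = (u - a.2) * t by linarith, abs_mul, abs_of_pos ht.1]
    exact mul_le_mul ((abs_sub _ _).trans (by linarith)) ht.2 ht.1.le hK.le
  have hres := hξ.abs_integral_sub_le hD hν (Y := fun ω => f (W h ω)) (g := g) (c := f u) (B := B)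
    (hf.comp_aemeasurable hW).aestronglyMeasurable (fun ω => hfB _) hgm hgB (hfB u) ?_ ?_
  · have e : ∫ a in D, (g a - f u) ∂ν = h * generator Vbar η pminus pplus f u := by
      simp only [hg, add_sub_cancel_left]
      exact setIntegral_hit hm hp H.vmin_pos (by linarith) hu hh hφm hφB
    rw [e] at hres
    refine hres.trans ?_
    rw [mul_assoc (4 * B), ← mul_pow]
    gcongr
  · filter_upwards [hE, hgood] with ω ⟨X, y, w, E⟩ hω hempty
    refine congrArg f (E.piston_free_flight (T := h) (fun a ha => ?_) h ⟨hh.le, le_rfl⟩)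
    refine hfar a (hcut ω hω a ha).2 fun haD => ?_
    exact (hempty ▸ (⟨ha, haD⟩ : a ∈ ξ ω ∩ D) : a ∈ (∅ : Set (ℝ × ℝ)))
  · filter_upwards [hE, hgood] with ω ⟨X, y, w, E⟩ hω a hone
    have ha : a ∈ ξ ω := (hone.symm ▸ mem_singleton a : a ∈ ξ ω ∩ D).1
    have hother : ∀ b ∈ ξ ω, b ≠ a → b ∉ D := fun b hb hba hbD =>
      hba (hone ▸ (⟨hb, hbD⟩ : b ∈ ξ ω ∩ D) : b ∈ ({a} : Set (ℝ × ℝ)))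
    obtain ⟨ha1, ha2⟩ := hcut ω hω a ha
    by_cases hhit : a ∈ hitSet u h
    · obtain ⟨τ, hτ, hτe⟩ := (exists_hit_iff hh (hne a ha1)).2 hhit
      rw [hgmem a hhit]
      have hk : reflect Vbar (pistonAfter m M u a.2) = kick Vbar η u a.2 := by
        rw [pistonAfter_eq hmM, kick]
      have := E.piston_one_collision (vmax := vmax) hu ha (hne a ha1) hτ hτe
        (fun b hb hba => ⟨(hcut ω hω b hb).2.le, not_le.1 (hother b hb hba)⟩)
        (hk ▸ H.abs_kick_result_le hu ha2.le)
        (by rw [hk, atomAfter_eq hmM]; exact H.atom_separates hu ha1 ha2.le)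
      rw [this, hk]
    · rw [hgnot a hhit]
      refine congrArg f (E.piston_free_flight (T := h) (fun b hb => ?_) h ⟨hh.le, le_rfl⟩)
      by_cases hba : b = a
      · subst hba
        intro t ht heq
        exact hhit ((exists_hit_iff hh (hne b ha1)).1 ⟨t, ht, heq⟩)
      · exact hfar b (hcut ω hω b hb).2 (hother b hb hba)

/-! ### The stationarity equation -/

lemma stronglyMeasurable_generator (hm : Measurable pminus) (hp : Measurable pplus) (Vbar η : ℝ)
    {f : ℝ → ℝ} (hf : Measurable f) :
    StronglyMeasurable (generator Vbar η pminus pplus f) := by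
  have h : Measurable fun z : ℝ × ℝ => (z.2 - z.1) * signedDensity pminus pplus z.2 *
      (f (kick Vbar η z.1 z.2) - f z.1) :=
    ((measurable_snd.sub measurable_fst).mul
      ((measurable_signedDensity hm hp).comp measurable_snd)).mul
      ((hf.comp (measurable_kick Vbar η)).sub (hf.comp measurable_fst))
  exact h.stronglyMeasurable.integral_prod_right'

lemma abs_rate_le (hm : IsGasDensity vmin vmax pminus) (hp : IsGasDensity vmin vmax pplus)
    {u : ℝ} (hu : |u| ≤ Vbar) (v : ℝ) :
    |(v - u) * signedDensity pminus pplus v| ≤ (vmax + Vbar) * (pminus v + pplus v) := by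
  by_cases hv : |v| ≤ vmin ∨ vmax ≤ |v|
  · simp [signedDensity_eq_zero hm hp hv, hm.cutoff v hv, hp.cutoff v hv]
  push Not at hv
  have h1 : |v - u| ≤ vmax + Vbar := (abs_sub _ _).trans (by linarith)
  rw [abs_mul]
  exact mul_le_mul h1 (abs_signedDensity_le hm hp v) (abs_nonneg _) ((abs_nonneg _).trans h1)

lemma abs_generator_integrand_le (hm : IsGasDensity vmin vmax pminus)
    (hp : IsGasDensity vmin vmax pplus) {η u B : ℝ} (H : IsHeavy vmin vmax Vbar η)
    (hu : |u| ≤ Vbar) {f : ℝ → ℝ} (hfB : ∀ x, |x| ≤ Vbar → |f x| ≤ B) (v : ℝ) :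
    |(v - u) * signedDensity pminus pplus v * (f (kick Vbar η u v) - f u)| ≤
      (vmax + Vbar) * (pminus v + pplus v) * (2 * B) := by
  by_cases hv : |v| ≤ vmin ∨ vmax ≤ |v|
  · simp [signedDensity_eq_zero hm hp hv, hm.cutoff v hv, hp.cutoff v hv]
  push Not at hv
  have h1 := abs_rate_le hm hp hu v
  have h2 := hfB _ (H.abs_kick_result_le hu hv.2.le)
  rw [abs_mul]
  exact mul_le_mul h1 ((abs_sub _ _).trans (by linarith [hfB u hu]))
    (abs_nonneg _) ((abs_nonneg _).trans h1)

lemma integrable_generator_integrand (hm : IsGasDensity vmin vmax pminus)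
    (hp : IsGasDensity vmin vmax pplus) {η u B : ℝ} (H : IsHeavy vmin vmax Vbar η)
    (hu : |u| ≤ Vbar) {f : ℝ → ℝ} (hf : Measurable f) (hfB : ∀ x, |x| ≤ Vbar → |f x| ≤ B) :
    Integrable fun v =>
      (v - u) * signedDensity pminus pplus v * (f (kick Vbar η u v) - f u) := by
  have hk : Measurable fun v => kick Vbar η u v :=
    (measurable_kick Vbar η).comp (by fun_prop : Measurable fun v : ℝ => (u, v))
  exact (((hm.integrable.add hp.integrable).const_mul _).mul_const _).mono'
    (((measurable_id.sub_const u).mul (measurable_signedDensity hm.measurable hp.measurable)).mul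
      ((hf.comp hk).sub_const _)).aestronglyMeasurable
    (.of_forall (abs_generator_integrand_le hm hp H hu hfB))

lemma integrable_generator (hm : IsGasDensity vmin vmax pminus)
    (hp : IsGasDensity vmin vmax pplus) {η B : ℝ} (H : IsHeavy vmin vmax Vbar η)
    {f : ℝ → ℝ} (hf : Measurable f) (hfB : ∀ x, |x| ≤ Vbar → |f x| ≤ B) {μ : Measure ℝ}
    [IsFiniteMeasure μ] (hμ : ∀ᵐ u ∂μ, |u| ≤ Vbar) :
    Integrable (generator Vbar η pminus pplus f) μ := by
  refine .of_bound (stronglyMeasurable_generator hm.measurable hp.measurable Vbar η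
    hf).aestronglyMeasurable (∫ v, (vmax + Vbar) * (pminus v + pplus v) * (2 * B))
    (hμ.mono fun u hu => ?_)
  exact norm_integral_le_of_norm_le
    (((hm.integrable.add hp.integrable).const_mul _).mul_const _)
    (.of_forall (abs_generator_integrand_le hm hp H hu hfB))

/-- In the integrated short-time expansion the zeroth-order terms cancel by invariance, leaving h·|∫
Lf dμ| ≤ C h² for every `h > 0`. -/
lemma IsStationary.integral_generator_of_bounded (hm : IsGasDensity vmin vmax pminus)
    (hp : IsGasDensity vmin vmax pplus) (hmM : M + m ≠ 0)
    (H : IsHeavy vmin vmax Vbar (2 * m / (M + m))) {μ : Measure ℝ}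
    (hμ : IsStationary m M Vbar pminus pplus μ) {B : ℝ} {f : ℝ → ℝ} (hf : Measurable f)
    (hfB : ∀ x, |f x| ≤ B) :
    ∫ u, generator Vbar (2 * m / (M + m)) pminus pplus f u ∂μ = 0 := by
  set η := 2 * m / (M + m) with hη
  have := hμ.prob
  obtain ⟨κ, hκ, hinv⟩ := hμ.invariant
  set C := 4 * B * (2 * (vmax + Vbar) * ∫ v, (pminus v + pplus v)) ^ 2 with hC
  have hexp : ∀ h, 0 < h → ∀ u, |u| ≤ Vbar →
      |(∫ x, f x ∂κ h u) - f u - h * generator Vbar η pminus pplus f u| ≤ C * h ^ 2 := by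
    intro h hh u hu
    obtain ⟨Ω, _, P, ξ, W, hP, hξ, hW, hE, hlaw⟩ := hκ u (abs_le.1 hu)
    rw [hlaw h hh.le, integral_map (hW h hh.le) hf.aestronglyMeasurable]
    exact abs_integral_sub_generator_le hm hp hmM H hu hh hf hfB hξ (hW h hh.le) hE
  have hfi : Integrable f μ := .of_bound hf.aestronglyMeasurable B (.of_forall hfB)
  have hsupp : ∀ᵐ u ∂μ, |u| ≤ Vbar := hμ.support.mono fun u hu => abs_le.2 hu
  have hgi : Integrable (generator Vbar η pminus pplus f) μ :=
    integrable_generator hm hp H hf (fun x _ => hfB x) hsupp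
  have hbound : ∀ h, 0 < h → |∫ u, generator Vbar η pminus pplus f u ∂μ| ≤ C * h := by
    intro h hh
    -- Writing `μ.bind (κ h)` as a composition with a constant kernel gives access to the
    -- integrability and Fubini statements for kernels.
    have hcomp : (κ h ∘ₖ Kernel.const Unit μ) () = μ := by
      rw [Kernel.comp_apply, Kernel.const_apply, hinv h hh.le]
    have hfi' : Integrable f ((κ h ∘ₖ Kernel.const Unit μ) ()) := by rwa [hcomp]
    have hi1 : Integrable (fun u => ∫ x, f x ∂κ h u) μ := by
      simpa using hfi'.integral_comp
    have hi2 : ∫ u, ∫ x, f x ∂κ h u ∂μ = ∫ u, f u ∂μ := by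
      have := Kernel.integral_comp hfi'
      rw [hcomp] at this
      simpa using this.symm
    have hz : ∫ u, ((∫ x, f x ∂κ h u) - f u - h * generator Vbar η pminus pplus f u) ∂μ =
        -(h * ∫ u, generator Vbar η pminus pplus f u ∂μ) := by
      have hi3 : Integrable (fun u => (∫ x, f x ∂κ h u) - f u) μ := hi1.sub hfi
      rw [integral_sub hi3 (hgi.const_mul h), integral_sub hi1 hfi, hi2,
        integral_const_mul]
      ring
    have hle := norm_integral_le_of_norm_le_const (μ := μ) (C := C * h ^ 2)
      (f := fun u => (∫ x, f x ∂κ h u) - f u - h * generator Vbar η pminus pplus f u)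
      (hsupp.mono fun u hu => hexp h hh u hu)
    rw [hz, norm_neg, norm_mul, Real.norm_eq_abs, Real.norm_eq_abs, abs_of_pos hh, probReal_univ,
      mul_one] at hle
    have : h * |∫ u, generator Vbar η pminus pplus f u ∂μ| ≤ h * (C * h) := by
      linarith
    exact le_of_mul_le_mul_left this hh
  have hlim : Tendsto (fun h : ℝ => C * h) (𝓝[>] 0) (𝓝 0) := by
    have : Tendsto (fun h : ℝ => C * h) (𝓝 0) (𝓝 (C * 0)) := tendsto_id.const_mul C
    rw [mul_zero] at this
    exact this.mono_left nhdsWithin_le_nhds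
  have := ge_of_tendsto hlim (eventually_nhdsWithin_of_forall fun h hh => hbound h hh)
  exact abs_eq_zero.1 (le_antisymm this (abs_nonneg _))

/-- A stationary measure annihilates the range of the generator. -/
theorem IsStationary.integral_generator (hm : IsGasDensity vmin vmax pminus)
    (hp : IsGasDensity vmin vmax pplus) (hmM : M + m ≠ 0)
    (H : IsHeavy vmin vmax Vbar (2 * m / (M + m))) {μ : Measure ℝ}
    (hμ : IsStationary m M Vbar pminus pplus μ) {f : ℝ → ℝ} (hf : Continuous f) :
    ∫ u, generator Vbar (2 * m / (M + m)) pminus pplus f u ∂μ = 0 := by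
  have hV : -Vbar ≤ Vbar := by linarith [H.Vbar_pos]
  -- Composition with the projection makes `f` bounded without changing it on [-Vbar, Vbar], where
  -- both `u` and the kicked velocity lie.
  set g : ℝ → ℝ := fun x => f (projIcc (-Vbar) Vbar hV x) with hg
  have hgc : Continuous g := hf.comp (continuous_subtype_val.comp continuous_projIcc)
  have hgf : ∀ x, |x| ≤ Vbar → g x = f x := fun x hx => by
    rw [hg]
    simp only
    rw [projIcc_of_mem hV (abs_le.1 hx)]
  obtain ⟨B, hB⟩ := (isCompact_Icc (a := -Vbar) (b := Vbar)).exists_bound_of_continuousOn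
    hf.continuousOn
  rw [← hμ.integral_generator_of_bounded hm hp hmM H hgc.measurable (B := B)
    fun x => hB _ (projIcc (-Vbar) Vbar hV x).2]
  refine integral_congr_ae (hμ.support.mono fun u hu => ?_)
  refine integral_congr_ae (.of_forall fun v => ?_)
  by_cases hv : |v| ≤ vmin ∨ vmax ≤ |v|
  · simp [signedDensity_eq_zero hm hp hv]
  · push Not at hv
    simp only
    rw [hgf u (abs_le.2 hu), hgf _ (H.abs_kick_result_le (abs_le.2 hu) hv.2.le)]

end ShortTime

end Piston

namespace Piston

/-! ### Moments of the gases -/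

section Moments

variable {vmin vmax Vbar : ℝ} {pminus pplus : ℝ → ℝ}

lemma integrable_signedDensity_mul (hm : IsGasDensity vmin vmax pminus)
    (hp : IsGasDensity vmin vmax pplus) {φ : ℝ → ℝ} {B : ℝ} (hφ : Measurable φ)
    (hB : ∀ v, |v| ≤ vmax → |φ v| ≤ B) :
    Integrable fun v => signedDensity pminus pplus v * φ v := by
  refine ((hm.integrable.add hp.integrable).mul_const B).mono'
    ((measurable_signedDensity hm.measurable hp.measurable).mul hφ).aestronglyMeasurable
    (.of_forall fun v => ?_)
  rw [norm_mul, Real.norm_eq_abs, Real.norm_eq_abs]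
  by_cases hv : |v| ≤ vmin ∨ vmax ≤ |v|
  · simp [signedDensity_eq_zero hm hp hv, hm.cutoff v hv, hp.cutoff v hv]
  · push Not at hv
    exact mul_le_mul (abs_signedDensity_le hm hp v) (hB v hv.2.le) (abs_nonneg _)
      (add_nonneg (hm.nonneg v) (hp.nonneg v))

lemma integrable_signedDensity_mul_of_continuous (hm : IsGasDensity vmin vmax pminus)
    (hp : IsGasDensity vmin vmax pplus) {φ : ℝ → ℝ} (hφ : Continuous φ) :
    Integrable fun v => signedDensity pminus pplus v * φ v := by
  obtain ⟨B, hB⟩ := (isCompact_Icc (a := -vmax) (b := vmax)).exists_bound_of_continuousOn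
    hφ.continuousOn
  exact integrable_signedDensity_mul hm hp hφ.measurable fun v hv => hB v (abs_le.1 hv)

lemma integrable_abs_signedDensity (hm : IsGasDensity vmin vmax pminus)
    (hp : IsGasDensity vmin vmax pplus) :
    Integrable fun v => |signedDensity pminus pplus v| := by
  simpa using (integrable_signedDensity_mul_of_continuous hm hp (φ := fun _ => 1)
    continuous_const).abs

lemma Q_eq_integral (hvmin : 0 < vmin) (hv : vmin < vmax) (hm : IsGasDensity vmin vmax pminus)
    (hp : IsGasDensity vmin vmax pplus) (k : ℕ) :
    Q vmin vmax pminus pplus k = ∫ v, signedDensity pminus pplus v * v ^ k := by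
  have e : ∀ v, signedDensity pminus pplus v * v ^ k =
      (Ioc vmin vmax).indicator (fun v => v ^ k * pminus v) v -
        (Ioc (-vmax) (-vmin)).indicator (fun v => v ^ k * pplus v) v := by
    intro v
    by_cases h1 : v ∈ Ioc vmin vmax
    · have h2 : v ∉ Ioc (-vmax) (-vmin) := fun h => by linarith [h1.1, h.2]
      rw [indicator_of_mem h1, indicator_of_notMem h2, signedDensity, if_pos (by linarith [h1.1])]
      ring
    by_cases h2 : v ∈ Ioc (-vmax) (-vmin)
    · rw [indicator_of_notMem h1, indicator_of_mem h2, signedDensity, if_neg (by linarith [h2.2])]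
      ring
    · rw [indicator_of_notMem h1, indicator_of_notMem h2, signedDensity_eq_zero hm hp]
      · simp
      by_contra! hc
      obtain ⟨hc1, hc2⟩ := hc
      rw [abs_lt] at hc2
      rcases lt_abs.1 hc1 with h | h
      · exact h1 ⟨h, hc2.2.le⟩
      · exact h2 ⟨hc2.1, by linarith⟩
  have hi : ∀ (p : ℝ → ℝ), IsGasDensity vmin vmax p → ∀ s : Set ℝ, MeasurableSet s →
      Integrable (s.indicator fun v => v ^ k * p v) := by
    intro p hp s hs
    refine Integrable.indicator ?_ hs
    refine (hp.integrable.const_mul (vmax ^ k)).mono'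
      ((by fun_prop : Measurable fun v : ℝ => v ^ k).mul hp.measurable).aestronglyMeasurable
      (.of_forall fun v => ?_)
    rw [norm_mul, norm_pow, Real.norm_eq_abs, Real.norm_eq_abs, abs_of_nonneg (hp.nonneg v)]
    by_cases hc : vmax ≤ |v|
    · simp [hp.cutoff v (Or.inr hc)]
    · gcongr
      · exact hp.nonneg v
      · exact (not_le.1 hc).le
  simp_rw [e]
  rw [integral_sub (hi _ hm _ measurableSet_Ioc) (hi _ hp _ measurableSet_Ioc),
    integral_indicator measurableSet_Ioc, integral_indicator measurableSet_Ioc, Q, Fminus, Fplus,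
    intervalIntegral.integral_of_le hv.le, intervalIntegral.integral_of_le (by linarith)]

/-- The collision rate is nonnegative, so pointwise upper bounds on the increment of a test function
can be integrated. -/
lemma signedDensity_mul_sub_nonneg (hm : IsGasDensity vmin vmax pminus)
    (hp : IsGasDensity vmin vmax pplus) {u : ℝ} (hu : |u| ≤ vmin) (v : ℝ) :
    0 ≤ signedDensity pminus pplus v * (v - u) := by
  by_cases hv : |v| ≤ vmin ∨ vmax ≤ |v|
  · simp [signedDensity_eq_zero hm hp hv]
  push Not at hv
  rw [abs_le] at hu
  have hvmin : 0 ≤ vmin := by linarith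
  unfold signedDensity
  rcases lt_abs.1 hv.1 with h | h
  · rw [if_pos (by linarith)]
    exact mul_nonneg (hm.nonneg v) (by linarith)
  · rw [if_neg (by linarith), neg_mul, ← mul_neg]
    exact mul_nonneg (hp.nonneg v) (by linarith)

lemma abs_signedDensity_mul_le (hm : IsGasDensity vmin vmax pminus)
    (hp : IsGasDensity vmin vmax pplus) (hvmin : 0 < vmin) (v : ℝ) :
    |signedDensity pminus pplus v| * vmin ≤ signedDensity pminus pplus v * v := by
  by_cases hv : |v| ≤ vmin ∨ vmax ≤ |v|
  · simp [signedDensity_eq_zero hm hp hv]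
  push Not at hv
  unfold signedDensity
  rcases lt_abs.1 hv.1 with h | h
  · rw [if_pos (by linarith), abs_of_nonneg (hm.nonneg v)]
    exact mul_le_mul_of_nonneg_left h.le (hm.nonneg v)
  · rw [if_neg (by linarith), abs_neg, abs_of_nonneg (hp.nonneg v), neg_mul, ← mul_neg]
    exact mul_le_mul_of_nonneg_left h.le (hp.nonneg v)

/-- By evenness the left gas has half of its mass on positive velocities. -/
lemma integral_abs_signedDensity_pos (hm : IsGasDensity vmin vmax pminus)
    (hp : IsGasDensity vmin vmax pplus) : 0 < ∫ v, |signedDensity pminus pplus v| := by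
  have h1 : ∫ v, pminus v = 2 * ∫ v in Ioi 0, pminus v := by
    rw [← integral_comp_abs]
    refine integral_congr_ae (.of_forall fun v => ?_)
    rcases abs_choice v with h | h <;> simp [h, hm.even]
  have h2 : 0 < ∫ v in Ioi 0, pminus v := by linarith [hm.pos]
  refine h2.trans_le ?_
  rw [← integral_indicator measurableSet_Ioi]
  refine integral_mono (hm.integrable.indicator measurableSet_Ioi)
    (integrable_abs_signedDensity hm hp) fun v => ?_
  by_cases hv : v ∈ Ioi (0 : ℝ)
  · rw [indicator_of_mem hv, signedDensity, if_pos (mem_Ioi.1 hv)]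
    exact le_abs_self _
  · rw [indicator_of_notMem hv]
    exact abs_nonneg _

lemma integral_abs_signedDensity_mul_le (hvmin : 0 < vmin) (hv : vmin < vmax)
    (hm : IsGasDensity vmin vmax pminus) (hp : IsGasDensity vmin vmax pplus) :
    (∫ v, |signedDensity pminus pplus v|) * vmin ≤ Q vmin vmax pminus pplus 1 := by
  rw [Q_eq_integral hvmin hv hm hp, ← integral_mul_const]
  refine integral_mono ((integrable_abs_signedDensity hm hp).mul_const _)
    (integrable_signedDensity_mul_of_continuous hm hp (by fun_prop)) fun v => ?_
  simpa using abs_signedDensity_mul_le hm hp hvmin v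

lemma Q_one_pos (hvmin : 0 < vmin) (hv : vmin < vmax)
    (hm : IsGasDensity vmin vmax pminus) (hp : IsGasDensity vmin vmax pplus) :
    0 < Q vmin vmax pminus pplus 1 :=
  (mul_pos (integral_abs_signedDensity_pos hm hp) hvmin).trans_le
    (integral_abs_signedDensity_mul_le hvmin hv hm hp)

/-- This lets the linear restoring drift dominate the quadratic term Q₀u² for |u| < vmin/3. -/
lemma abs_Q_zero_mul_le (hvmin : 0 < vmin) (hv : vmin < vmax)
    (hm : IsGasDensity vmin vmax pminus) (hp : IsGasDensity vmin vmax pplus) :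
    |Q vmin vmax pminus pplus 0| * vmin ≤ Q vmin vmax pminus pplus 1 := by
  refine le_trans ?_ (integral_abs_signedDensity_mul_le hvmin hv hm hp)
  refine mul_le_mul_of_nonneg_right ?_ hvmin.le
  rw [Q_eq_integral hvmin hv hm hp]
  simpa using abs_integral_le_integral_abs (f := signedDensity pminus pplus) (μ := volume)

/-- The moments of the relative velocity. -/
noncomputable def relativeMoment (pminus pplus : ℝ → ℝ) (j : ℕ) (u : ℝ) : ℝ :=
  ∫ v, signedDensity pminus pplus v * (v - u) ^ j

lemma integrable_relativeMoment (hm : IsGasDensity vmin vmax pminus)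
    (hp : IsGasDensity vmin vmax pplus) (j : ℕ) (u : ℝ) :
    Integrable fun v => signedDensity pminus pplus v * (v - u) ^ j :=
  integrable_signedDensity_mul_of_continuous hm hp (by fun_prop)

lemma relativeMoment_eq_sum (hvmin : 0 < vmin) (hv : vmin < vmax)
    (hm : IsGasDensity vmin vmax pminus) (hp : IsGasDensity vmin vmax pplus) (j : ℕ) (u : ℝ) :
    relativeMoment pminus pplus j u = ∑ k ∈ Finset.range (j + 1),
      (-u) ^ (j - k) * j.choose k * Q vmin vmax pminus pplus k := by
  have hi := integrable_relativeMoment hm hp (u := 0)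
  simp only [sub_zero] at hi
  simp only [Q_eq_integral hvmin hv hm hp, relativeMoment, ← integral_const_mul]
  rw [← integral_finsetSum _ fun k _ => (hi k).const_mul _]
  refine integral_congr_ae (.of_forall fun v => ?_)
  simp only [sub_eq_add_neg, add_pow, Finset.mul_sum]
  exact Finset.sum_congr rfl fun k _ => by ring

lemma relativeMoment_two (hvmin : 0 < vmin) (hv : vmin < vmax)
    (hm : IsGasDensity vmin vmax pminus) (hp : IsGasDensity vmin vmax pplus) (u : ℝ) :
    relativeMoment pminus pplus 2 u = Q vmin vmax pminus pplus 2 -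
      2 * Q vmin vmax pminus pplus 1 * u + Q vmin vmax pminus pplus 0 * u ^ 2 := by
  rw [relativeMoment_eq_sum hvmin hv hm hp]
  simp [Finset.sum_range_succ]
  ring

lemma relativeMoment_three (hvmin : 0 < vmin) (hv : vmin < vmax)
    (hm : IsGasDensity vmin vmax pminus) (hp : IsGasDensity vmin vmax pplus) (u : ℝ) :
    relativeMoment pminus pplus 3 u = Q vmin vmax pminus pplus 3 -
      3 * Q vmin vmax pminus pplus 2 * u + 3 * Q vmin vmax pminus pplus 1 * u ^ 2 -
      Q vmin vmax pminus pplus 0 * u ^ 3 := by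
  rw [relativeMoment_eq_sum hvmin hv hm hp]
  simp [Finset.sum_range_succ, Nat.choose]
  ring

lemma abs_relativeMoment_le (hm : IsGasDensity vmin vmax pminus)
    (hp : IsGasDensity vmin vmax pplus) (j : ℕ) {u : ℝ} (hu : |u| ≤ Vbar) :
    |relativeMoment pminus pplus j u| ≤
      (vmax + Vbar) ^ j * ∫ v, |signedDensity pminus pplus v| := by
  rw [relativeMoment, mul_comm, ← integral_mul_const, ← Real.norm_eq_abs]
  refine norm_integral_le_of_norm_le ((integrable_abs_signedDensity hm hp).mul_const _)
    (.of_forall fun v => ?_)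
  rw [norm_mul, norm_pow, Real.norm_eq_abs, Real.norm_eq_abs]
  by_cases hv : |v| ≤ vmin ∨ vmax ≤ |v|
  · simp [signedDensity_eq_zero hm hp hv]
  · push Not at hv
    have : |v - u| ≤ vmax + Vbar := (abs_sub _ _).trans (by linarith)
    gcongr

lemma stronglyMeasurable_relativeMoment (hm : Measurable pminus) (hp : Measurable pplus) (j : ℕ) :
    StronglyMeasurable (relativeMoment pminus pplus j) := by
  have h : Measurable fun z : ℝ × ℝ => signedDensity pminus pplus z.2 * (z.2 - z.1) ^ j :=
    ((measurable_signedDensity hm hp).comp measurable_snd).mul (by fun_prop)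
  exact h.stronglyMeasurable.integral_prod_right'

end Moments

end Piston

namespace Piston

/-! ### Concentration of the stationary measure -/

/-- Reflection never increases the speed, so it can only help in the bound for exp(a u²/η). -/
lemma abs_reflect_le_abs {Vbar V : ℝ} (h : |V| ≤ 3 * Vbar) : |reflect Vbar V| ≤ |V| := by
  have h0 : 0 ≤ Vbar := by linarith [abs_nonneg V]
  have := le_abs_self V
  have := neg_abs_le V
  unfold reflect
  split_ifs
  · exact abs_le.2 ⟨by linarith, by linarith⟩
  · exact abs_le.2 ⟨by linarith, by linarith⟩
  · exact le_rfl

lemma reflect_eq_self {Vbar V : ℝ} (h : |V| ≤ Vbar) : reflect Vbar V = V := by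
  rw [abs_le] at h
  rw [reflect, if_neg (not_lt.2 h.2), if_neg (not_lt.2 h.1)]

/-- Since `u` is inside the walls, the overshoot is at most |d|, and reflection moves the point by
twice the overshoot. -/
lemma abs_reflect_add_sub_le {Vbar u d : ℝ} (hu : |u| ≤ Vbar) :
    |reflect Vbar (u + d) - (u + d)| ≤ 2 * |d| := by
  rw [abs_le] at hu
  have := le_abs_self d
  have := neg_abs_le d
  unfold reflect
  split_ifs
  · exact abs_le.2 ⟨by linarith, by linarith⟩
  · exact abs_le.2 ⟨by linarith, by linarith⟩
  · simp

/-- `μ` is a probability measure on `[-Vbar, Vbar]` that annihilates the range of the generator. -/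
structure IsGeneratorInvariant (Vbar η : ℝ) (pminus pplus : ℝ → ℝ) (μ : Measure ℝ) : Prop where
  prob : IsProbabilityMeasure μ
  support : ∀ᵐ u ∂μ, |u| ≤ Vbar
  annihilates : ∀ f : ℝ → ℝ, Continuous f → ∫ u, generator Vbar η pminus pplus f u ∂μ = 0

lemma exists_abs_le_of_continuous {f : ℝ → ℝ} (hf : Continuous f) (V : ℝ) :
    ∃ B, ∀ x, |x| ≤ V → |f x| ≤ B := by
  obtain ⟨B, hB⟩ := (isCompact_Icc (a := -V) (b := V)).exists_bound_of_continuousOn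
    hf.continuousOn
  exact ⟨B, fun x hx => hB x (abs_le.1 hx)⟩

section

variable {vmin vmax Vbar η : ℝ} {pminus pplus : ℝ → ℝ} {μ : Measure ℝ}

lemma IsHeavy.le_one (H : IsHeavy vmin vmax Vbar η) : η ≤ 1 := by
  by_contra! h
  nlinarith [H.small_kick, H.vmin_pos, H.vmin_lt, H.Vbar_pos]

lemma IsGeneratorInvariant.integrable (hμ : IsGeneratorInvariant Vbar η pminus pplus μ)
    {f : ℝ → ℝ} (hf : Continuous f) : Integrable f μ := by
  have := hμ.prob
  obtain ⟨B, hB⟩ := exists_abs_le_of_continuous hf Vbar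
  exact .of_bound hf.aestronglyMeasurable B (hμ.support.mono fun x hx => hB x hx)

/-- The exponent changes by at most x = a(2uz + ηz²) with z = v - u, in which 1/η has cancelled. The
bound on `a` makes |x| ≤ 1, so exp x - 1 ≤ x + x². -/
lemma exp_kick_sub_le (H : IsHeavy vmin vmax Vbar η) {a u v : ℝ} (ha : 0 < a)
    (ha' : 3 * a * (vmax + Vbar) ^ 2 ≤ 1) (hu : |u| ≤ Vbar) (hv : |v| ≤ vmax) :
    Real.exp (a / η * kick Vbar η u v ^ 2) - Real.exp (a / η * u ^ 2) ≤
      Real.exp (a / η * u ^ 2) * (a * (2 * u * (v - u) + η * (v - u) ^ 2) +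
        a ^ 2 * (8 * (vmax + Vbar) ^ 2 * u ^ 2 + 2 * η * (vmax + Vbar) ^ 4)) := by
  have hη := H.pos
  have hη1 := H.le_one
  have hVpos := H.Vbar_pos
  set K := vmax + Vbar with hK
  have hKV : Vbar ≤ K := by linarith [H.vmin_pos, H.vmin_lt]
  have hKpos : 0 < K := by linarith
  set z := v - u with hz
  have hzK : |z| ≤ K := (abs_sub _ _).trans (by linarith)
  have hkick := H.abs_kick_le hu hv
  rw [← hz] at hkick
  have hz2 : z ^ 2 ≤ K ^ 2 := sq_le_sq.2 (by rwa [abs_of_pos hKpos])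
  have hk2 : kick Vbar η u v ^ 2 ≤ (u + η * z) ^ 2 :=
    sq_le_sq.2 (abs_reflect_le_abs ((abs_add_le _ _).trans (by linarith)))
  set x := a * (2 * u * z + η * z ^ 2) with hx
  have hexp : a / η * (u + η * z) ^ 2 = a / η * u ^ 2 + x := by
    rw [hx]; field_simp; ring
  have huz : |u * z| ≤ K ^ 2 := by
    rw [abs_mul, sq]
    exact mul_le_mul (hu.trans hKV) hzK (abs_nonneg _) hKpos.le
  have hηz0 : 0 ≤ η * z ^ 2 := by positivity
  have hηz : η * z ^ 2 ≤ K ^ 2 := by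
    simpa using mul_le_mul hη1 hz2 (sq_nonneg z) zero_le_one
  have hx1 : |x| ≤ 1 := by
    rw [hx, abs_mul, abs_of_pos ha]
    have : |2 * u * z + η * z ^ 2| ≤ 3 * K ^ 2 := by
      rw [abs_le] at huz ⊢
      constructor <;> linarith [huz.1, huz.2, sq_nonneg K]
    linarith [mul_le_mul_of_nonneg_left this ha.le]
  have hx2 : x ^ 2 ≤ a ^ 2 * (8 * K ^ 2 * u ^ 2 + 2 * η * K ^ 4) := by
    rw [hx, mul_pow]
    refine mul_le_mul_of_nonneg_left ?_ (sq_nonneg a)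
    have h1 : (2 * u * z + η * z ^ 2) ^ 2 ≤ 8 * (u ^ 2 * z ^ 2) + 2 * (η * z ^ 2) ^ 2 := by
      nlinarith [sq_nonneg (2 * u * z - η * z ^ 2)]
    have h2 : u ^ 2 * z ^ 2 ≤ u ^ 2 * K ^ 2 := mul_le_mul_of_nonneg_left hz2 (sq_nonneg u)
    have h3 : (η * z ^ 2) ^ 2 ≤ η * K ^ 4 := by
      have : (η * z ^ 2) * (η * z ^ 2) ≤ (η * K ^ 2) * K ^ 2 :=
        mul_le_mul (mul_le_mul_of_nonneg_left hz2 hη.le) hηz (by positivity) (by positivity)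
      linarith
    linarith
  have hexpx : Real.exp x - 1 ≤ x + a ^ 2 * (8 * K ^ 2 * u ^ 2 + 2 * η * K ^ 4) := by
    have := (abs_le.1 (Real.abs_exp_sub_one_sub_id_le hx1)).2
    linarith
  have h1 : Real.exp (a / η * kick Vbar η u v ^ 2) ≤
      Real.exp (a / η * u ^ 2) * Real.exp x := by
    rw [← Real.exp_add, ← hexp]
    exact Real.exp_le_exp.2 (mul_le_mul_of_nonneg_left hk2 (by positivity))
  linarith [mul_le_mul_of_nonneg_left hexpx (Real.exp_pos (a / η * u ^ 2)).le]

/-- Weighting the pointwise bound by the collision rate produces the relative moments of orders 2, 3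
and 1: the drift, the noise and the quadratic remainder. Smallness of `a` makes the remainder cost
only part of the drift. -/
lemma generator_exp_le (hm : IsGasDensity vmin vmax pminus) (hp : IsGasDensity vmin vmax pplus)
    (hQ2 : Q vmin vmax pminus pplus 2 = 0) (H : IsHeavy vmin vmax Vbar η) {a u : ℝ} (ha : 0 < a)
    (ha₁ : 3 * a * (vmax + Vbar) ^ 2 ≤ 1)
    (ha₂ : 8 * a * (vmax + Vbar) ^ 3 * (∫ v, |signedDensity pminus pplus v|) ≤
      Q vmin vmax pminus pplus 1) (hu : |u| ≤ Vbar) :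
    generator Vbar η pminus pplus (fun w => Real.exp (a / η * w ^ 2)) u ≤
      a * (Real.exp (a / η * u ^ 2) * (-2 * Q vmin vmax pminus pplus 1 * u ^ 2 +
        3 * (vmax + Vbar) ^ 3 * (∫ v, |signedDensity pminus pplus v|) * η)) := by
  have hη := H.pos
  have hVv := H.Vbar_lt
  have hVpos := H.Vbar_pos
  set K := vmax + Vbar with hK
  have hKpos : 0 < K := by linarith [H.vmin_pos, H.vmin_lt]
  set A := ∫ v, |signedDensity pminus pplus v| with hA
  have hApos : 0 < A := integral_abs_signedDensity_pos hm hp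
  set f : ℝ → ℝ := fun w => Real.exp (a / η * w ^ 2) with hf
  have hfc : Continuous f := by fun_prop
  obtain ⟨B, hB⟩ := exists_abs_le_of_continuous hfc Vbar
  set b := 8 * K ^ 2 * u ^ 2 + 2 * η * K ^ 4 with hb
  have hb0 : 0 ≤ b := by positivity
  have hT := fun j => integrable_relativeMoment hm hp j u
  have hRi : Integrable fun v => f u * (a * (2 * u * (signedDensity pminus pplus v * (v - u) ^ 2) +
      η * (signedDensity pminus pplus v * (v - u) ^ 3)) +
      a ^ 2 * b * (signedDensity pminus pplus v * (v - u) ^ 1)) :=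
    (((((hT 2).const_mul (2 * u)).add ((hT 3).const_mul η)).const_mul a).add
      ((hT 1).const_mul (a ^ 2 * b))).const_mul (f u)
  have h1 : generator Vbar η pminus pplus f u ≤
      f u * (a * (2 * u * relativeMoment pminus pplus 2 u + η * relativeMoment pminus pplus 3 u) +
        a ^ 2 * b * relativeMoment pminus pplus 1 u) := by
    have e : ∫ v, f u * (a * (2 * u * (signedDensity pminus pplus v * (v - u) ^ 2) +
      η * (signedDensity pminus pplus v * (v - u) ^ 3)) +
      a ^ 2 * b * (signedDensity pminus pplus v * (v - u) ^ 1)) =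
      f u * (a * (2 * u * relativeMoment pminus pplus 2 u + η * relativeMoment pminus pplus 3 u) +
        a ^ 2 * b * relativeMoment pminus pplus 1 u) := by
      have i1 : Integrable fun v => 2 * u * (signedDensity pminus pplus v * (v - u) ^ 2) +
          η * (signedDensity pminus pplus v * (v - u) ^ 3) :=
        ((hT 2).const_mul (2 * u)).add ((hT 3).const_mul η)
      rw [integral_const_mul, integral_add (i1.const_mul a) ((hT 1).const_mul _),
        integral_const_mul, integral_add ((hT 2).const_mul _) ((hT 3).const_mul _),
        integral_const_mul, integral_const_mul, integral_const_mul]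
      rfl
    rw [← e]
    refine integral_mono (integrable_generator_integrand hm hp H hu hfc.measurable hB) hRi
      fun v => ?_
    by_cases hv : |v| ≤ vmin ∨ vmax ≤ |v|
    · simp [signedDensity_eq_zero hm hp hv]
    push Not at hv
    have h2 := mul_le_mul_of_nonneg_left (exp_kick_sub_le H ha ha₁ hu hv.2.le)
      (signedDensity_mul_sub_nonneg hm hp (by linarith : |u| ≤ vmin) v)
    rw [mul_comm (v - u)]
    refine h2.trans (le_of_eq ?_)
    simp only [hf, hb]
    ring
  refine h1.trans ?_
  have hT1 := (le_abs_self _).trans (abs_relativeMoment_le hm hp 1 hu)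
  have hT3 := (le_abs_self _).trans (abs_relativeMoment_le hm hp 3 hu)
  rw [pow_one] at hT1
  rw [relativeMoment_two H.vmin_pos H.vmin_lt hm hp, hQ2]
  rw [← hA, ← hK] at hT1 hT3
  set Q₁ := Q vmin vmax pminus pplus 1
  set Q₀ := Q vmin vmax pminus pplus 0
  have hQ₁ : 0 < Q₁ := Q_one_pos H.vmin_pos H.vmin_lt hm hp
  have hQ₀ : |Q₀| * vmin ≤ Q₁ := abs_Q_zero_mul_le H.vmin_pos H.vmin_lt hm hp
  have hQ₀u : Q₀ * u ≤ Q₁ / 3 := by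
    have h2 : |Q₀| * |u| ≤ |Q₀| * (vmin / 3) :=
      mul_le_mul_of_nonneg_left (by linarith) (abs_nonneg _)
    have h3 := le_abs_self (Q₀ * u)
    rw [abs_mul] at h3
    linarith
  -- The left side is -4Q₁u² + 2Q₀u³, and the cubic term costs at most (2/3)Q₁u².
  have hdrift : 2 * u * (0 - 2 * Q₁ * u + Q₀ * u ^ 2) ≤ -3 * Q₁ * u ^ 2 := by
    have := mul_le_mul_of_nonneg_right hQ₀u (sq_nonneg u)
    nlinarith [mul_nonneg hQ₁.le (sq_nonneg u)]
  have hdiff : η * relativeMoment pminus pplus 3 u ≤ η * (K ^ 3 * A) :=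
    mul_le_mul_of_nonneg_left hT3 hη.le
  -- The u² part of `b` is absorbed by `ha₂`, the η part by aK² ≤ 1.
  have hquad : a * b * relativeMoment pminus pplus 1 u ≤ Q₁ * u ^ 2 + 2 * K ^ 3 * A * η := by
    have s1 : a * b * relativeMoment pminus pplus 1 u ≤ a * b * (K * A) :=
      mul_le_mul_of_nonneg_left hT1 (by positivity)
    have s2 : a * b * (K * A) = 8 * a * K ^ 3 * A * u ^ 2 + a * K ^ 2 * (2 * K ^ 3 * A * η) := by
      rw [hb]; ring
    have s3 : 8 * a * K ^ 3 * A * u ^ 2 ≤ Q₁ * u ^ 2 :=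
      mul_le_mul_of_nonneg_right ha₂ (sq_nonneg u)
    have s4 : a * K ^ 2 * (2 * K ^ 3 * A * η) ≤ 1 * (2 * K ^ 3 * A * η) :=
      mul_le_mul_of_nonneg_right (by nlinarith [mul_pos ha (pow_pos hKpos 2)]) (by positivity)
    linarith
  have hsum : 2 * u * (0 - 2 * Q₁ * u + Q₀ * u ^ 2) + η * relativeMoment pminus pplus 3 u +
      a * b * relativeMoment pminus pplus 1 u ≤ -2 * Q₁ * u ^ 2 + 3 * K ^ 3 * A * η := by
    linarith
  have hfu : 0 ≤ a * f u := mul_nonneg ha.le (Real.exp_pos _).le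
  have := mul_le_mul_of_nonneg_left hsum hfu
  calc _ = a * f u * (2 * u * (0 - 2 * Q₁ * u + Q₀ * u ^ 2) + η * relativeMoment pminus pplus 3 u +
      a * b * relativeMoment pminus pplus 1 u) := by ring
    _ ≤ _ := this
    _ = _ := by ring

/-- Gaussian concentration of the invariant measure at scale `√η`. -/
lemma IsGeneratorInvariant.integral_exp_le (hm : IsGasDensity vmin vmax pminus)
    (hp : IsGasDensity vmin vmax pplus) (hQ2 : Q vmin vmax pminus pplus 2 = 0)
    (H : IsHeavy vmin vmax Vbar η) {a : ℝ} (ha : 0 < a) (ha₁ : 3 * a * (vmax + Vbar) ^ 2 ≤ 1)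
    (ha₂ : 8 * a * (vmax + Vbar) ^ 3 * (∫ v, |signedDensity pminus pplus v|) ≤
      Q vmin vmax pminus pplus 1)
    (hμ : IsGeneratorInvariant Vbar η pminus pplus μ) :
    ∫ u, Real.exp (a / η * u ^ 2) ∂μ ≤
      2 * Real.exp (a * (3 * (vmax + Vbar) ^ 3 * (∫ v, |signedDensity pminus pplus v|)) /
        Q vmin vmax pminus pplus 1) := by
  have := hμ.prob
  have hη := H.pos
  have hQ₁ : 0 < Q vmin vmax pminus pplus 1 := Q_one_pos H.vmin_pos H.vmin_lt hm hp
  set Q₁ := Q vmin vmax pminus pplus 1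
  have hApos : 0 < ∫ v, |signedDensity pminus pplus v| := integral_abs_signedDensity_pos hm hp
  have hKpos : 0 < vmax + Vbar := by linarith [H.vmin_pos, H.vmin_lt, H.Vbar_pos]
  set b := 3 * (vmax + Vbar) ^ 3 * (∫ v, |signedDensity pminus pplus v|) with hb
  have hbpos : 0 < b := by positivity
  set f : ℝ → ℝ := fun w => Real.exp (a / η * w ^ 2) with hf
  have hfc : Continuous f := by fun_prop
  obtain ⟨B, hB⟩ := exists_abs_le_of_continuous hfc Vbar
  set R := Real.exp (a * b / Q₁) with hR
  have hi : Integrable (fun u => f u * (-2 * Q₁ * u ^ 2 + b * η)) μ := hμ.integrable (by fun_prop)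
  have h0 : 0 ≤ ∫ u, f u * (-2 * Q₁ * u ^ 2 + b * η) ∂μ := by
    have := integral_mono_ae (integrable_generator hm hp H hfc.measurable hB hμ.support)
      (hi.const_mul a) (hμ.support.mono fun u hu => generator_exp_le hm hp hQ2 H ha ha₁ ha₂ hu)
    rw [hμ.annihilates f hfc, integral_const_mul] at this
    exact nonneg_of_mul_nonneg_right this ha
  -- Either Q₁u² ≥ bη, and the drift is at most -bη, or the exponent is at most ab/Q₁ and so `f u ≤
  -- R`.
  have hpt : ∀ u, b * η * f u ≤ 2 * b * η * R - f u * (-2 * Q₁ * u ^ 2 + b * η) := by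
    intro u
    have hfpos : 0 < f u := Real.exp_pos _
    have hRpos : 0 < R := Real.exp_pos _
    rcases le_total (b * η) (Q₁ * u ^ 2) with h | h
    · have := mul_le_mul_of_nonneg_left h hfpos.le
      have : 0 < 2 * b * η * R := by positivity
      linarith
    · have hfR : f u ≤ R := by
        refine Real.exp_le_exp.2 ?_
        rw [div_mul_eq_mul_div, div_le_div_iff₀ hη hQ₁]
        nlinarith
      have h1 : f u * (2 * b * η - 2 * Q₁ * u ^ 2) ≤ R * (2 * b * η) := by
        refine mul_le_mul hfR ?_ (by linarith) hRpos.le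
        linarith [mul_nonneg hQ₁.le (sq_nonneg u)]
      linarith
  have hfin := integral_mono ((hμ.integrable hfc).const_mul (b * η))
    ((integrable_const (2 * b * η * R)).sub hi) hpt
  have hsub : ∫ u, (2 * b * η * R - f u * (-2 * Q₁ * u ^ 2 + b * η)) ∂μ =
      2 * b * η * R - ∫ u, f u * (-2 * Q₁ * u ^ 2 + b * η) ∂μ := by
    rw [integral_sub (integrable_const _) hi]
    simp
  rw [integral_const_mul] at hfin
  have hfin' : b * η * ∫ u, f u ∂μ ≤ b * η * (2 * R) := by
    refine hfin.trans ?_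
    change ∫ u, (2 * b * η * R - f u * (-2 * Q₁ * u ^ 2 + b * η)) ∂μ ≤ _
    rw [hsub]
    linarith
  exact le_of_mul_le_mul_left hfin' (by positivity)

/-! ### The reflection is exponentially negligible -/

/-- A kick is at most Vbar/2, so reflection acts only if |u| ≥ Vbar/2. There the product `e` of the
two exponentials is at least 1, and reflection displaces the velocity by at most 2η(vmax + Vbar). -/
lemma abs_generator_sub_le (hm : IsGasDensity vmin vmax pminus)
    (hp : IsGasDensity vmin vmax pplus) (H : IsHeavy vmin vmax Vbar η) {a u L : ℝ} (ha : 0 < a)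
    (hu : |u| ≤ Vbar) {f : ℝ → ℝ} (hf : Continuous f) (hL0 : 0 ≤ L)
    (hL : ∀ x y, |x| ≤ 2 * Vbar → |y| ≤ 2 * Vbar → |f x - f y| ≤ L * |x - y|) :
    |generator Vbar η pminus pplus f u -
        ∫ v, signedDensity pminus pplus v * ((v - u) * (f (u + η * (v - u)) - f u))| ≤
      2 * L * (vmax + Vbar) ^ 2 * (∫ v, |signedDensity pminus pplus v|) * η *
        Real.exp (-(a * Vbar ^ 2 / 4) / η) * Real.exp (a / η * u ^ 2) := by
  have hη := H.pos
  have hVpos := H.Vbar_pos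
  have hKpos : 0 < vmax + Vbar := by linarith [H.vmin_pos, H.vmin_lt]
  obtain ⟨B, hB⟩ := exists_abs_le_of_continuous hf Vbar
  have hi1 := integrable_generator_integrand hm hp H hu hf.measurable hB
  have hi2 := integrable_signedDensity_mul_of_continuous hm hp
    (φ := fun v => (v - u) * (f (u + η * (v - u)) - f u)) (by fun_prop)
  set e := Real.exp (-(a * Vbar ^ 2 / 4) / η) * Real.exp (a / η * u ^ 2) with he
  have hepos : 0 < e := by positivity
  have hefar : Vbar / 2 ≤ |u| → 1 ≤ e := by
    intro h
    rw [he, ← Real.exp_add, Real.one_le_exp_iff]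
    have h1 : (Vbar / 2) ^ 2 ≤ u ^ 2 := sq_le_sq.2 (by rwa [abs_of_pos (by linarith)])
    have : -(a * Vbar ^ 2 / 4) / η + a / η * u ^ 2 = a / η * (u ^ 2 - (Vbar / 2) ^ 2) := by ring
    rw [this]
    exact mul_nonneg (by positivity) (by linarith)
  rw [generator, ← integral_sub hi1 hi2, ← Real.norm_eq_abs]
  refine (norm_integral_le_of_norm_le ((integrable_abs_signedDensity hm hp).mul_const
    (2 * L * (vmax + Vbar) ^ 2 * η * e)) (.of_forall fun v => ?_)).trans (le_of_eq ?_)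
  · by_cases hv : |v| ≤ vmin ∨ vmax ≤ |v|
    · simp [signedDensity_eq_zero hm hp hv]
    push Not at hv
    have hk := H.abs_kick_le hu hv.2.le
    have hz : |v - u| ≤ vmax + Vbar := (abs_sub _ _).trans (by linarith)
    have e1 : (v - u) * signedDensity pminus pplus v * (f (kick Vbar η u v) - f u) -
        signedDensity pminus pplus v * ((v - u) * (f (u + η * (v - u)) - f u)) =
        signedDensity pminus pplus v * ((v - u) * (f (kick Vbar η u v) - f (u + η * (v - u)))) := by
      ring
    rw [e1, norm_mul, Real.norm_eq_abs, Real.norm_eq_abs]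
    refine mul_le_mul_of_nonneg_left ?_ (abs_nonneg _)
    rcases lt_or_ge |u| (Vbar / 2) with hlt | hge
    · rw [kick, reflect_eq_self ((abs_add_le _ _).trans (by linarith)), sub_self, mul_zero, abs_zero]
      positivity
    · have h1 : |f (kick Vbar η u v) - f (u + η * (v - u))| ≤
          L * (2 * (η * (vmax + Vbar))) := by
        refine (hL _ _ ((H.abs_kick_result_le hu hv.2.le).trans (by linarith))
          ((abs_add_le _ _).trans (by linarith))).trans ?_
        refine mul_le_mul_of_nonneg_left ?_ hL0
        refine (abs_reflect_add_sub_le hu).trans ?_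
        rw [abs_mul, abs_of_pos hη]
        gcongr
      rw [abs_mul]
      calc |v - u| * |f (kick Vbar η u v) - f (u + η * (v - u))|
          ≤ (vmax + Vbar) * (L * (2 * (η * (vmax + Vbar)))) :=
            mul_le_mul hz h1 (abs_nonneg _) hKpos.le
        _ = 2 * L * (vmax + Vbar) ^ 2 * η * 1 := by ring
        _ ≤ 2 * L * (vmax + Vbar) ^ 2 * η * e :=
            mul_le_mul_of_nonneg_left (hefar hge) (by positivity)
  · rw [integral_mul_const, he]
    ring

/-- Here ηG is the generator without reflection. The reflection error also carries a factor η, so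
dividing by η loses nothing. -/
lemma IsGeneratorInvariant.abs_integral_le (hm : IsGasDensity vmin vmax pminus)
    (hp : IsGasDensity vmin vmax pplus) (H : IsHeavy vmin vmax Vbar η) {a L E : ℝ} (ha : 0 < a)
    (hμ : IsGeneratorInvariant Vbar η pminus pplus μ)
    (hE : ∫ u, Real.exp (a / η * u ^ 2) ∂μ ≤ E) {f G : ℝ → ℝ} (hf : Continuous f) (hL0 : 0 ≤ L)
    (hL : ∀ x y, |x| ≤ 2 * Vbar → |y| ≤ 2 * Vbar → |f x - f y| ≤ L * |x - y|)
    (hG : Integrable G μ)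
    (hGf : ∀ u, ∫ v, signedDensity pminus pplus v * ((v - u) * (f (u + η * (v - u)) - f u)) =
      η * G u) :
    |∫ u, G u ∂μ| ≤ 2 * L * (vmax + Vbar) ^ 2 * (∫ v, |signedDensity pminus pplus v|) * E *
      Real.exp (-(a * Vbar ^ 2 / 4) / η) := by
  have := hμ.prob
  have hη := H.pos
  obtain ⟨B, hB⟩ := exists_abs_le_of_continuous hf Vbar
  have hgi := integrable_generator hm hp H hf.measurable hB hμ.support
  set c := 2 * L * (vmax + Vbar) ^ 2 * (∫ v, |signedDensity pminus pplus v|) with hc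
  have hc0 : 0 ≤ c := by
    have := integral_abs_signedDensity_pos hm hp
    positivity
  set e := Real.exp (-(a * Vbar ^ 2 / 4) / η)
  have hz : ∫ u, (generator Vbar η pminus pplus f u - η * G u) ∂μ = -(η * ∫ u, G u ∂μ) := by
    rw [integral_sub hgi (hG.const_mul η), hμ.annihilates f hf, integral_const_mul, zero_sub]
  have hexpi : Integrable (fun u => Real.exp (a / η * u ^ 2)) μ := hμ.integrable (by fun_prop)
  have hle : ‖∫ u, (generator Vbar η pminus pplus f u - η * G u) ∂μ‖ ≤
      ∫ u, c * η * e * Real.exp (a / η * u ^ 2) ∂μ :=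
    norm_integral_le_of_norm_le (hexpi.const_mul _) (hμ.support.mono fun u hu => by
      rw [← hGf u]
      exact abs_generator_sub_le hm hp H ha hu hf hL0 hL)
  rw [hz, norm_neg, norm_mul, Real.norm_eq_abs, Real.norm_eq_abs, abs_of_pos hη,
    integral_const_mul] at hle
  have h2 : c * η * e * ∫ u, Real.exp (a / η * u ^ 2) ∂μ ≤ c * η * e * E :=
    mul_le_mul_of_nonneg_left hE (by positivity)
  have h3 : η * |∫ u, G u ∂μ| ≤ η * (c * E * e) := by linarith
  exact le_of_mul_le_mul_left h3 hη

end

end Piston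

namespace Piston

/-! ### Moments of the stationary measure -/

lemma IsStationary.isGeneratorInvariant {vmin vmax Vbar m M : ℝ} {pminus pplus : ℝ → ℝ}
    (hm : IsGasDensity vmin vmax pminus) (hp : IsGasDensity vmin vmax pplus) (hmM : M + m ≠ 0)
    (H : IsHeavy vmin vmax Vbar (2 * m / (M + m))) {μ : Measure ℝ}
    (hμ : IsStationary m M Vbar pminus pplus μ) :
    IsGeneratorInvariant Vbar (2 * m / (M + m)) pminus pplus μ :=
  ⟨hμ.prob, hμ.support.mono fun _ hu => abs_le.2 hu,
    fun _ hf => hμ.integral_generator hm hp hmM H hf⟩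

lemma integral_linear_combination {α : Type*} [MeasurableSpace α] {μ : Measure α}
    {f g h k : α → ℝ} (hf : Integrable f μ) (hg : Integrable g μ) (hh : Integrable h μ)
    (hk : Integrable k μ) (a b c d : ℝ) :
    ∫ x, (a * f x + b * g x + c * h x + d * k x) ∂μ =
      a * (∫ x, f x ∂μ) + b * (∫ x, g x ∂μ) + c * (∫ x, h x ∂μ) + d * ∫ x, k x ∂μ := by
  have h1 : Integrable (fun x => a * f x + b * g x) μ := (hf.const_mul a).add (hg.const_mul b)
  have h2 : Integrable (fun x => a * f x + b * g x + c * h x) μ := h1.add (hh.const_mul c)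
  rw [integral_add h2 (hk.const_mul d), integral_add h1 (hh.const_mul c),
    integral_add (hf.const_mul a) (hg.const_mul b)]
  simp only [integral_const_mul]

namespace IsGeneratorInvariant

variable {vmin vmax Vbar η a E : ℝ} {pminus pplus : ℝ → ℝ} {μ : Measure ℝ}

/-- Here x ≤ exp x at x = a u²/η; the fourth moment uses x²/2 ≤ exp x. -/
lemma integral_sq_le (ha : 0 < a) (hη : 0 < η)
    (hμ : IsGeneratorInvariant Vbar η pminus pplus μ)
    (hE : ∫ u, Real.exp (a / η * u ^ 2) ∂μ ≤ E) : ∫ u, u ^ 2 ∂μ ≤ E / a * η := by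
  have h1 : ∫ u, a / η * u ^ 2 ∂μ ≤ ∫ u, Real.exp (a / η * u ^ 2) ∂μ :=
    integral_mono (hμ.integrable (by fun_prop)) (hμ.integrable (by fun_prop)) fun u => by
      linarith [Real.add_one_le_exp (a / η * u ^ 2)]
  rw [integral_const_mul] at h1
  have h2 := h1.trans hE
  rw [div_mul_eq_mul_div, div_le_iff₀ hη] at h2
  rw [div_mul_eq_mul_div, le_div_iff₀ ha]
  linarith

lemma integral_pow_four_le (ha : 0 < a) (hη : 0 < η)
    (hμ : IsGeneratorInvariant Vbar η pminus pplus μ)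
    (hE : ∫ u, Real.exp (a / η * u ^ 2) ∂μ ≤ E) : ∫ u, u ^ 4 ∂μ ≤ 2 * E / a ^ 2 * η ^ 2 := by
  have h1 : ∫ u, a ^ 2 / (2 * η ^ 2) * u ^ 4 ∂μ ≤ ∫ u, Real.exp (a / η * u ^ 2) ∂μ :=
    integral_mono (hμ.integrable (by fun_prop)) (hμ.integrable (by fun_prop)) fun u => by
      have hx : 0 ≤ a / η * u ^ 2 := by positivity
      have h2 := Real.quadratic_le_exp_of_nonneg hx
      have h3 : a ^ 2 / (2 * η ^ 2) * u ^ 4 = (a / η * u ^ 2) ^ 2 / 2 := by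
        field_simp
      simp only [h3]
      linarith
  rw [integral_const_mul] at h1
  have h2 := h1.trans hE
  rw [div_mul_eq_mul_div, div_le_iff₀ (by positivity)] at h2
  rw [div_mul_eq_mul_div, le_div_iff₀ (by positivity)]
  linarith

/-- A crude bound, only of order η; the third moment equation improves it to η². -/
lemma abs_integral_pow_three_le (hμ : IsGeneratorInvariant Vbar η pminus pplus μ) :
    |∫ u, u ^ 3 ∂μ| ≤ Vbar * ∫ u, u ^ 2 ∂μ := by
  rw [← integral_const_mul, ← Real.norm_eq_abs]
  refine norm_integral_le_of_norm_le (hμ.integrable (by fun_prop)) (hμ.support.mono fun u hu => ?_)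
  rw [norm_pow, Real.norm_eq_abs, ← sq_abs u, pow_succ, mul_comm]
  exact mul_le_mul_of_nonneg_right hu (by positivity)

lemma integral_relativeMoment_two (hm : IsGasDensity vmin vmax pminus)
    (hp : IsGasDensity vmin vmax pplus) (H : IsHeavy vmin vmax Vbar η)
    (hμ : IsGeneratorInvariant Vbar η pminus pplus μ) (k : ℕ) :
    Integrable (fun u => u ^ k * relativeMoment pminus pplus 2 u) μ ∧
    ∫ u, u ^ k * relativeMoment pminus pplus 2 u ∂μ =
      Q vmin vmax pminus pplus 2 * (∫ u, u ^ k ∂μ) -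
        2 * Q vmin vmax pminus pplus 1 * (∫ u, u ^ (k + 1) ∂μ) +
        Q vmin vmax pminus pplus 0 * ∫ u, u ^ (k + 2) ∂μ := by
  have hi : ∀ j : ℕ, Integrable (fun u : ℝ => u ^ j) μ := fun j => hμ.integrable (by fun_prop)
  simp only [relativeMoment_two H.vmin_pos H.vmin_lt hm hp]
  refine ⟨hμ.integrable (by fun_prop), ?_⟩
  have h := integral_linear_combination (hi k) (hi (k + 1)) (hi (k + 2)) (hi 0)
    (Q vmin vmax pminus pplus 2) (-2 * Q vmin vmax pminus pplus 1) (Q vmin vmax pminus pplus 0) 0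
  rw [zero_mul, add_zero] at h
  refine (integral_congr_ae (.of_forall fun u => ?_)).trans (h.trans ?_) <;> ring

lemma integral_relativeMoment_three (hm : IsGasDensity vmin vmax pminus)
    (hp : IsGasDensity vmin vmax pplus) (H : IsHeavy vmin vmax Vbar η)
    (hμ : IsGeneratorInvariant Vbar η pminus pplus μ) (k : ℕ) :
    Integrable (fun u => u ^ k * relativeMoment pminus pplus 3 u) μ ∧
    ∫ u, u ^ k * relativeMoment pminus pplus 3 u ∂μ =
      Q vmin vmax pminus pplus 3 * (∫ u, u ^ k ∂μ) -
        3 * Q vmin vmax pminus pplus 2 * (∫ u, u ^ (k + 1) ∂μ) +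
        3 * Q vmin vmax pminus pplus 1 * (∫ u, u ^ (k + 2) ∂μ) -
        Q vmin vmax pminus pplus 0 * ∫ u, u ^ (k + 3) ∂μ := by
  have hi : ∀ j : ℕ, Integrable (fun u : ℝ => u ^ j) μ := fun j => hμ.integrable (by fun_prop)
  simp only [relativeMoment_three H.vmin_pos H.vmin_lt hm hp]
  refine ⟨hμ.integrable (by fun_prop), ?_⟩
  have h := integral_linear_combination (hi k) (hi (k + 1)) (hi (k + 2)) (hi (k + 3))
    (Q vmin vmax pminus pplus 3) (-3 * Q vmin vmax pminus pplus 2)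
    (3 * Q vmin vmax pminus pplus 1) (-Q vmin vmax pminus pplus 0)
  refine (integral_congr_ae (.of_forall fun u => ?_)).trans (h.trans ?_) <;> ring

lemma abs_first_moment_le (hm : IsGasDensity vmin vmax pminus)
    (hp : IsGasDensity vmin vmax pplus) (H : IsHeavy vmin vmax Vbar η) (ha : 0 < a)
    (hμ : IsGeneratorInvariant Vbar η pminus pplus μ)
    (hE : ∫ u, Real.exp (a / η * u ^ 2) ∂μ ≤ E) :
    |Q vmin vmax pminus pplus 2 - 2 * Q vmin vmax pminus pplus 1 * (∫ u, u ∂μ) +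
        Q vmin vmax pminus pplus 0 * ∫ u, u ^ 2 ∂μ| ≤
      2 * 1 * (vmax + Vbar) ^ 2 * (∫ v, |signedDensity pminus pplus v|) * E *
        Real.exp (-(a * Vbar ^ 2 / 4) / η) := by
  have := hμ.prob
  obtain ⟨hi, he⟩ := hμ.integral_relativeMoment_two hm hp H 0
  simp only [pow_zero, one_mul, integral_const, probReal_univ, smul_eq_mul, mul_one, zero_add,
    pow_one] at hi he
  rw [← he]
  refine hμ.abs_integral_le hm hp H ha hE continuous_id zero_le_one
    (fun x y _ _ => by simp) hi fun u => ?_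
  rw [relativeMoment, ← integral_const_mul]
  exact integral_congr_ae (.of_forall fun v => by simp only [id]; ring)

lemma abs_second_moment_le (hm : IsGasDensity vmin vmax pminus)
    (hp : IsGasDensity vmin vmax pplus) (H : IsHeavy vmin vmax Vbar η) (ha : 0 < a)
    (hμ : IsGeneratorInvariant Vbar η pminus pplus μ)
    (hE : ∫ u, Real.exp (a / η * u ^ 2) ∂μ ≤ E) (hQ2 : Q vmin vmax pminus pplus 2 = 0) :
    |2 * (-(2 * Q vmin vmax pminus pplus 1 * ∫ u, u ^ 2 ∂μ) +
        Q vmin vmax pminus pplus 0 * ∫ u, u ^ 3 ∂μ) +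
      η * (Q vmin vmax pminus pplus 3 + 3 * Q vmin vmax pminus pplus 1 * (∫ u, u ^ 2 ∂μ) -
        Q vmin vmax pminus pplus 0 * ∫ u, u ^ 3 ∂μ)| ≤
      2 * (4 * Vbar) * (vmax + Vbar) ^ 2 * (∫ v, |signedDensity pminus pplus v|) * E *
        Real.exp (-(a * Vbar ^ 2 / 4) / η) := by
  have := hμ.prob
  obtain ⟨hi₂, he₂⟩ := hμ.integral_relativeMoment_two hm hp H 1
  obtain ⟨hi₃, he₃⟩ := hμ.integral_relativeMoment_three hm hp H 0
  simp only [hQ2, pow_zero, one_mul, integral_const, probReal_univ, smul_eq_mul, mul_one, zero_add,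
    pow_one, zero_mul, mul_zero, zero_sub, sub_zero, Nat.reduceAdd] at hi₂ he₂ hi₃ he₃
  rw [← he₂, ← he₃, ← integral_const_mul, ← integral_const_mul,
    ← integral_add (hi₂.const_mul _) (hi₃.const_mul _)]
  have hT := integrable_relativeMoment hm hp
  refine hμ.abs_integral_le hm hp H ha hE (f := fun w => w ^ 2) (by fun_prop)
    (by linarith [H.Vbar_pos]) (fun x y hx hy => ?_) ((hi₂.const_mul _).add (hi₃.const_mul _))
    fun u => ?_
  · rw [show x ^ 2 - y ^ 2 = (x + y) * (x - y) by ring, abs_mul]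
    exact mul_le_mul_of_nonneg_right ((abs_add_le _ _).trans (by linarith)) (abs_nonneg _)
  · simp only [relativeMoment]
    rw [← integral_const_mul, ← integral_const_mul, ← integral_const_mul,
      ← integral_add (((hT _ _).const_mul _).const_mul _) ((hT _ _).const_mul _),
      ← integral_const_mul]
    exact integral_congr_ae (.of_forall fun v => by ring)

/-- Test function w³, with increment η(3u²z + 3ηuz² + η²z³) where z = v - u. The last term gives the
integral `T` of the fourth relative moment, for which a bound suffices. -/
lemma abs_third_moment_le (hm : IsGasDensity vmin vmax pminus)
    (hp : IsGasDensity vmin vmax pplus) (H : IsHeavy vmin vmax Vbar η) (ha : 0 < a)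
    (hμ : IsGeneratorInvariant Vbar η pminus pplus μ)
    (hE : ∫ u, Real.exp (a / η * u ^ 2) ∂μ ≤ E) (hQ2 : Q vmin vmax pminus pplus 2 = 0) :
    ∃ T, |T| ≤ (vmax + Vbar) ^ 4 * (∫ v, |signedDensity pminus pplus v|) ∧
    |3 * (-(2 * Q vmin vmax pminus pplus 1 * ∫ u, u ^ 3 ∂μ) +
        Q vmin vmax pminus pplus 0 * ∫ u, u ^ 4 ∂μ) +
      3 * η * (Q vmin vmax pminus pplus 3 * (∫ u, u ∂μ) +
        3 * Q vmin vmax pminus pplus 1 * (∫ u, u ^ 3 ∂μ) -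
        Q vmin vmax pminus pplus 0 * ∫ u, u ^ 4 ∂μ) + η ^ 2 * T| ≤
      2 * (12 * Vbar ^ 2) * (vmax + Vbar) ^ 2 * (∫ v, |signedDensity pminus pplus v|) * E *
        Real.exp (-(a * Vbar ^ 2 / 4) / η) := by
  have := hμ.prob
  obtain ⟨hi₂, he₂⟩ := hμ.integral_relativeMoment_two hm hp H 2
  obtain ⟨hi₃, he₃⟩ := hμ.integral_relativeMoment_three hm hp H 1
  simp only [hQ2, zero_mul, mul_zero, zero_sub, sub_zero, pow_one, Nat.reduceAdd] at hi₂ he₂ hi₃ he₃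
  have hle₄ : ∀ᵐ u ∂μ, ‖relativeMoment pminus pplus 4 u‖ ≤
      (vmax + Vbar) ^ 4 * (∫ v, |signedDensity pminus pplus v|) :=
    hμ.support.mono fun u hu => abs_relativeMoment_le hm hp 4 hu
  have hi₄ : Integrable (relativeMoment pminus pplus 4) μ :=
    .of_bound (stronglyMeasurable_relativeMoment hm.measurable hp.measurable
      4).aestronglyMeasurable _ hle₄
  refine ⟨∫ u, relativeMoment pminus pplus 4 u ∂μ, ?_, ?_⟩
  · simpa using norm_integral_le_of_norm_le_const hle₄
  have hi₂₃ : Integrable (fun u => 3 * (u ^ 2 * relativeMoment pminus pplus 2 u) +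
      3 * η * (u * relativeMoment pminus pplus 3 u)) μ := (hi₂.const_mul _).add (hi₃.const_mul _)
  rw [← he₂, ← he₃, ← integral_const_mul, ← integral_const_mul, ← integral_const_mul,
    ← integral_add (hi₂.const_mul _) (hi₃.const_mul _), ← integral_add hi₂₃ (hi₄.const_mul _)]
  have hT := integrable_relativeMoment hm hp
  refine hμ.abs_integral_le hm hp H ha hE (f := fun w => w ^ 3) (by fun_prop)
    (by positivity) (fun x y hx hy => ?_)
    (hi₂₃.add (hi₄.const_mul _)) fun u => ?_
  · rw [show x ^ 3 - y ^ 3 = (x ^ 2 + x * y + y ^ 2) * (x - y) by ring, abs_mul]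
    refine mul_le_mul_of_nonneg_right ?_ (abs_nonneg _)
    have h1 : |x| ^ 2 ≤ (2 * Vbar) ^ 2 := pow_le_pow_left₀ (abs_nonneg _) hx 2
    have h2 : |y| ^ 2 ≤ (2 * Vbar) ^ 2 := pow_le_pow_left₀ (abs_nonneg _) hy 2
    have h3 : |x| * |y| ≤ (2 * Vbar) * (2 * Vbar) :=
      mul_le_mul hx hy (abs_nonneg _) ((abs_nonneg _).trans hx)
    refine (abs_add_three _ _ _).trans ?_
    rw [abs_mul, abs_pow, abs_pow]
    linarith
  · have h := integral_linear_combination (hT 2 u) (hT 3 u) (hT 4 u) (hT 0 u)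
      -- The fourth summand is padding with coefficient 0.
      (η * (3 * u ^ 2)) (η * (3 * η * u)) (η * η ^ 2) 0
    refine (integral_congr_ae (.of_forall fun v => ?_)).trans (h.trans ?_)
    · ring
    · simp only [relativeMoment]
      ring

end IsGeneratorInvariant

/-! ### Solving the moment equations -/

lemma abs_mul_le_mul_pow {q x b t : ℝ} (h : |x| ≤ b * t) : |q * x| ≤ |q| * b * t := by
  rw [abs_mul, mul_assoc]
  exact mul_le_mul_of_nonneg_left h (abs_nonneg q)

/-- The first two moments are determined up to `O(η²)` by the first three moment equations. -/
lemma exists_moment_expansion (Q₀ Q₁ Q₃ b : ℝ) (hQ₁ : 0 < Q₁) :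
    ∃ C, 0 ≤ C ∧ ∀ η W₁ W₂ W₃ W₄ T : ℝ, 0 < η → η ≤ 1 →
      |-(2 * Q₁ * W₁) + Q₀ * W₂| ≤ b * η ^ 2 →
      |2 * (-(2 * Q₁ * W₂) + Q₀ * W₃) + η * (Q₃ + 3 * Q₁ * W₂ - Q₀ * W₃)| ≤ b * η ^ 2 →
      |3 * (-(2 * Q₁ * W₃) + Q₀ * W₄) + 3 * η * (Q₃ * W₁ + 3 * Q₁ * W₃ - Q₀ * W₄) + η ^ 2 * T| ≤
        b * η ^ 2 →
      |W₂| ≤ b * η → |W₃| ≤ b * η → |W₄| ≤ b * η ^ 2 → |T| ≤ b →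
      |W₂ - Q₃ / (4 * Q₁) * η| ≤ C * η ^ 2 ∧ |W₁ - Q₀ * Q₃ / (8 * Q₁ ^ 2) * η| ≤ C * η ^ 2 := by
  -- Constants in order of use: W₁ = O(η) from the first equation, W₃ = O(η²) from the third, then
  -- W₂ from the second and W₁ again from the first, both up to O(η²).
  set b₁ := (|Q₀| * b + b) / (2 * Q₁) with hb₁
  set b₃ := (2 * b + 6 * |Q₀| * b + 3 * |Q₃| * b₁ + 9 * Q₁ * b) / (6 * Q₁) with hb₃
  set b₂ := (2 * |Q₀| * b₃ + 3 * Q₁ * b + |Q₀| * b + b) / (4 * Q₁) with hb₂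
  set c₁ := (|Q₀| * b₂ + b) / (2 * Q₁) with hc₁
  -- The 0 ensures C ≥ 0: that `b ≥ 0` follows only once `T` is given.
  refine ⟨max 0 (max b₂ c₁), le_max_left _ _, ?_⟩
  intro η W₁ W₂ W₃ W₄ T hη hη1 h1 h2 h3 hW₂ hW₃ hW₄ hT
  have hb : 0 ≤ b := (abs_nonneg T).trans hT
  have hη2 : η ^ 2 ≤ η := by nlinarith
  have hη2' : 0 < η ^ 2 := by positivity
  have ebb₁ : b₁ * (2 * Q₁) = |Q₀| * b + b := by rw [hb₁]; field_simp
  have ebb₃ : b₃ * (6 * Q₁) = 2 * b + 6 * |Q₀| * b + 3 * |Q₃| * b₁ + 9 * Q₁ * b := by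
    rw [hb₃]; field_simp
  have ebb₂ : b₂ * (4 * Q₁) = 2 * |Q₀| * b₃ + 3 * Q₁ * b + |Q₀| * b + b := by
    rw [hb₂]; field_simp
  have ecc₁ : c₁ * (2 * Q₁) = |Q₀| * b₂ + b := by rw [hc₁]; field_simp
  have hbη : b * η ^ 2 ≤ b * η := mul_le_mul_of_nonneg_left hη2 hb
  have hQW₂ := abs_mul_le_mul_pow (q := Q₀) hW₂
  have hW₁ : |W₁| ≤ b₁ * η := by
    have h4 : |2 * Q₁ * W₁| ≤ 2 * Q₁ * (b₁ * η) := by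
      have e : 2 * Q₁ * (b₁ * η) = |Q₀| * b * η + b * η := by
        linear_combination η * ebb₁
      rw [e]
      rw [abs_le] at *
      constructor <;> linarith
    rw [abs_mul, abs_of_pos (by positivity : 0 < 2 * Q₁)] at h4
    exact le_of_mul_le_mul_left h4 (by positivity)
  have hηx : ∀ {x c : ℝ}, |x| ≤ c * η → |η * x| ≤ c * η ^ 2 := fun {x c} hx => by
    rw [abs_mul, abs_of_pos hη]
    nlinarith
  have hW₃' : |W₃| ≤ b₃ * η ^ 2 := by
    have t1 := abs_mul_le_mul_pow (q := Q₀) hW₄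
    have t2 := abs_mul_le_mul_pow (q := Q₃) (hηx hW₁)
    have t3 := abs_mul_le_mul_pow (q := Q₁) (hηx hW₃)
    have t4 : |η * (Q₀ * W₄)| ≤ |Q₀| * b * η ^ 2 := by
      rw [abs_mul, abs_of_pos hη]
      nlinarith [abs_nonneg (Q₀ * W₄)]
    have t5 : |η ^ 2 * T| ≤ b * η ^ 2 := by
      rw [abs_mul, abs_of_pos hη2', mul_comm]
      exact mul_le_mul_of_nonneg_right hT hη2'.le
    rw [abs_of_pos hQ₁] at t3
    have h4 : |6 * Q₁ * W₃| ≤ 6 * Q₁ * (b₃ * η ^ 2) := by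
      have e : 6 * Q₁ * (b₃ * η ^ 2) = 2 * (b * η ^ 2) + 6 * (|Q₀| * b * η ^ 2) +
          3 * (|Q₃| * b₁ * η ^ 2) + 9 * (Q₁ * b * η ^ 2) := by
        linear_combination η ^ 2 * ebb₃
      rw [e]
      rw [abs_le] at *
      constructor <;> linarith
    rw [abs_mul, abs_of_pos (by positivity : 0 < 6 * Q₁)] at h4
    exact le_of_mul_le_mul_left h4 (by positivity)
  have hW₂' : |W₂ - Q₃ / (4 * Q₁) * η| ≤ b₂ * η ^ 2 := by
    have t1 := abs_mul_le_mul_pow (q := Q₀) hW₃'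
    have t2 := abs_mul_le_mul_pow (q := Q₀) (hηx hW₃)
    have t3 := abs_mul_le_mul_pow (q := Q₁) (hηx hW₂)
    rw [abs_of_pos hQ₁] at t3
    have h4 : |4 * Q₁ * (W₂ - Q₃ / (4 * Q₁) * η)| ≤ 4 * Q₁ * (b₂ * η ^ 2) := by
      have e : 4 * Q₁ * (b₂ * η ^ 2) = 2 * (|Q₀| * b₃ * η ^ 2) + 3 * (Q₁ * b * η ^ 2) +
          |Q₀| * b * η ^ 2 + b * η ^ 2 := by
        linear_combination η ^ 2 * ebb₂
      have e' : 4 * Q₁ * (W₂ - Q₃ / (4 * Q₁) * η) = 4 * (Q₁ * W₂) - Q₃ * η := by field_simp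
      rw [e, e']
      rw [abs_le] at *
      constructor <;> linarith
    rw [abs_mul, abs_of_pos (by positivity : 0 < 4 * Q₁)] at h4
    exact le_of_mul_le_mul_left h4 (by positivity)
  have hW₁' : |W₁ - Q₀ * Q₃ / (8 * Q₁ ^ 2) * η| ≤ c₁ * η ^ 2 := by
    have t1 := abs_mul_le_mul_pow (q := Q₀) hW₂'
    have h4 : |2 * Q₁ * (W₁ - Q₀ * Q₃ / (8 * Q₁ ^ 2) * η)| ≤ 2 * Q₁ * (c₁ * η ^ 2) := by
      have e : 2 * Q₁ * (c₁ * η ^ 2) = |Q₀| * b₂ * η ^ 2 + b * η ^ 2 := by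
        linear_combination η ^ 2 * ecc₁
      have e' : 2 * Q₁ * (W₁ - Q₀ * Q₃ / (8 * Q₁ ^ 2) * η) =
          Q₀ * (W₂ - Q₃ / (4 * Q₁) * η) - (-(2 * Q₁ * W₁) + Q₀ * W₂) := by field_simp; ring
      rw [e, e']
      exact (abs_sub _ _).trans (by linarith)
    rw [abs_mul, abs_of_pos (by positivity : 0 < 2 * Q₁)] at h4
    exact le_of_mul_le_mul_left h4 (by positivity)
  exact ⟨hW₂'.trans (mul_le_mul_of_nonneg_right ((le_max_left _ _).trans (le_max_right _ _)) hη2'.le),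
    hW₁'.trans (mul_le_mul_of_nonneg_right ((le_max_right _ _).trans (le_max_right _ _)) hη2'.le)⟩

/-- Used to absorb the exponentially small errors into O(η²). -/
lemma exp_neg_div_le {c η : ℝ} (hc : 0 < c) (hη : 0 < η) :
    Real.exp (-c / η) ≤ 2 / c ^ 2 * η ^ 2 := by
  have hx : 0 < c / η := by positivity
  have h1 := Real.quadratic_le_exp_of_nonneg hx.le
  rw [neg_div, Real.exp_neg]
  have h2 : (c / η) ^ 2 / 2 ≤ Real.exp (c / η) := by linarith
  have h3 : 2 / c ^ 2 * η ^ 2 = ((c / η) ^ 2 / 2)⁻¹ := by field_simp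
  rw [h3]
  exact inv_anti₀ (by positivity) h2

end Piston

namespace Piston

/-- The moment identities and the moment expansion, in terms of `η = 2m/(M+m)`. -/
theorem exists_moment_bounds {vmin vmax Vbar : ℝ} (hvmin : 0 < vmin) (hvmax : vmin < vmax)
    (hV : 0 < Vbar) {pminus pplus : ℝ → ℝ} (hminus : IsGasDensity vmin vmax pminus)
    (hplus : IsGasDensity vmin vmax pplus) {q : ℕ → ℝ} (hq : q = Q vmin vmax pminus pplus)
    (hq2 : q 2 = 0) :
    ∃ D > 0, ∃ c > 0, ∃ C₀, 0 ≤ C₀ ∧ ∀ η, IsHeavy vmin vmax Vbar η → ∀ μ : Measure ℝ,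
      IsGeneratorInvariant Vbar η pminus pplus μ →
      |(∫ w, w ^ 2 ∂μ) - q 3 / (4 * q 1) * η| ≤ C₀ * η ^ 2 ∧
      |(∫ w, w ∂μ) - q 0 * q 3 / (8 * q 1 ^ 2) * η| ≤ C₀ * η ^ 2 ∧
      |q 2 - 2 * q 1 * (∫ w, w ∂μ) + q 0 * (∫ w, w ^ 2 ∂μ)| ≤ D * Real.exp (-c / η) ∧
      |2 * (-(2 * q 1 * ∫ w, w ^ 2 ∂μ) + q 0 * ∫ w, w ^ 3 ∂μ) +
          η * (q 3 + 3 * q 1 * (∫ w, w ^ 2 ∂μ) - q 0 * ∫ w, w ^ 3 ∂μ)| ≤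
        D * Real.exp (-c / η) := by
  have hQ₁ : 0 < q 1 := hq ▸ Q_one_pos hvmin hvmax hminus hplus
  obtain ⟨A, hA⟩ : ∃ A, A = ∫ v, |signedDensity pminus pplus v| := ⟨_, rfl⟩
  have hApos : 0 < A := hA ▸ integral_abs_signedDensity_pos hminus hplus
  obtain ⟨K, hK⟩ : ∃ K, K = vmax + Vbar := ⟨_, rfl⟩
  have hKpos : 0 < K := by linarith
  obtain ⟨a, ha, ha₁, ha₂⟩ : ∃ a > 0, 3 * a * K ^ 2 ≤ 1 ∧ 8 * a * K ^ 3 * A ≤ q 1 := by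
    refine ⟨min (1 / (3 * K ^ 2)) (q 1 / (8 * K ^ 3 * A)), lt_min (by positivity) (by positivity),
      ?_, ?_⟩
    · have := (le_div_iff₀ (by positivity)).1
        (min_le_left (1 / (3 * K ^ 2)) (q 1 / (8 * K ^ 3 * A)))
      linarith
    · have := (le_div_iff₀ (by positivity)).1
        (min_le_right (1 / (3 * K ^ 2)) (q 1 / (8 * K ^ 3 * A)))
      linarith
  obtain ⟨E, hE_def⟩ : ∃ x, x = 2 * Real.exp (a * (3 * K ^ 3 * A) / q 1) := ⟨_, rfl⟩
  have hE0 : 0 < E := by rw [hE_def]; positivity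
  -- `L` exceeds the Lipschitz constants 1, 4Vbar and 12Vbar² of w, w², w³ on [-2Vbar, 2Vbar].
  obtain ⟨L, hL⟩ : ∃ x, x = 1 + 4 * Vbar + 12 * Vbar ^ 2 := ⟨_, rfl⟩
  obtain ⟨D, hD⟩ : ∃ x, x = 2 * L * K ^ 2 * A * E := ⟨_, rfl⟩
  have hD0 : 0 < D := by rw [hD, hL]; positivity
  have hLD : ∀ l, l ≤ L → 2 * l * K ^ 2 * A * E ≤ D := fun l hl => by rw [hD]; gcongr
  obtain ⟨c, hc⟩ : ∃ x, x = a * Vbar ^ 2 / 4 := ⟨_, rfl⟩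
  have hc0 : 0 < c := by rw [hc]; positivity
  -- One constant for all inputs of the expansion: the summands bound the exponential errors, W₂ and
  -- W₃, W₄, and T.
  obtain ⟨b, hb⟩ : ∃ x, x = D * (2 / c ^ 2) + (1 + Vbar) * (E / a) + 2 * E / a ^ 2 + K ^ 4 * A :=
    ⟨_, rfl⟩
  obtain ⟨C₀, hC₀, hexpand⟩ := exists_moment_expansion (q 0) (q 1) (q 3) b hQ₁
  refine ⟨D, hD0, c, hc0, C₀, hC₀, fun η H μ hinv => ?_⟩
  have hη := H.pos
  have hqq2 : Q vmin vmax pminus pplus 2 = 0 := by rw [← hq, hq2]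
  have hEle := hinv.integral_exp_le hminus hplus hqq2 H ha (hK ▸ ha₁)
    (by rw [← hq, ← hA, ← hK]; exact ha₂)
  rw [← hq, ← hA, ← hK, ← hE_def] at hEle
  have hI₁ := hinv.abs_first_moment_le hminus hplus H ha hEle
  have hI₂ := hinv.abs_second_moment_le hminus hplus H ha hEle hqq2
  obtain ⟨T, hT, hI₃⟩ := hinv.abs_third_moment_le hminus hplus H ha hEle hqq2
  have hsq := hinv.integral_sq_le ha hη hEle
  have hfour := hinv.integral_pow_four_le ha hη hEle
  have hthree := hinv.abs_integral_pow_three_le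
  rw [← hq] at hI₁ hI₂ hI₃
  rw [← hA, ← hK] at hI₁ hI₂ hI₃ hT
  rw [← hc] at hI₁ hI₂ hI₃
  have hsq0 : 0 ≤ ∫ u, u ^ 2 ∂μ := integral_nonneg fun u => sq_nonneg u
  have hfour0 : 0 ≤ ∫ u, u ^ 4 ∂μ := integral_nonneg fun u => by positivity
  set W₁ := ∫ u, u ∂μ
  set W₂ := ∫ u, u ^ 2 ∂μ
  set W₃ := ∫ u, u ^ 3 ∂μ
  set W₄ := ∫ u, u ^ 4 ∂μ
  obtain ⟨e, he⟩ : ∃ e, e = Real.exp (-c / η) := ⟨_, rfl⟩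
  rw [← he] at hI₁ hI₂ hI₃ ⊢
  have he0 : 0 < e := he ▸ Real.exp_pos _
  replace hI₁ := hI₁.trans (mul_le_mul_of_nonneg_right
    (hLD 1 (by rw [hL]; linarith [sq_nonneg Vbar])) he0.le)
  replace hI₂ := hI₂.trans (mul_le_mul_of_nonneg_right
    (hLD (4 * Vbar) (by rw [hL]; linarith [sq_nonneg Vbar])) he0.le)
  replace hI₃ := hI₃.trans (mul_le_mul_of_nonneg_right
    (hLD (12 * Vbar ^ 2) (by rw [hL]; linarith [sq_nonneg Vbar])) he0.le)
  have hEa : 0 < E / a := by positivity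
  have hDb : D * (2 / c ^ 2) ≤ b := by
    have : 0 ≤ (1 + Vbar) * (E / a) + 2 * E / a ^ 2 + K ^ 4 * A := by positivity
    rw [hb]; linarith
  have hEb : (1 + Vbar) * (E / a) ≤ b := by
    have : 0 ≤ D * (2 / c ^ 2) + 2 * E / a ^ 2 + K ^ 4 * A := by positivity
    rw [hb]; linarith
  have hEb' : 2 * E / a ^ 2 ≤ b := by
    have : 0 ≤ D * (2 / c ^ 2) + (1 + Vbar) * (E / a) + K ^ 4 * A := by positivity
    rw [hb]; linarith
  have hKb : K ^ 4 * A ≤ b := by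
    have : 0 ≤ D * (2 / c ^ 2) + (1 + Vbar) * (E / a) + 2 * E / a ^ 2 := by positivity
    rw [hb]; linarith
  have heb : D * e ≤ b * η ^ 2 := by
    have h1 := mul_le_mul_of_nonneg_left (exp_neg_div_le hc0 hη) hD0.le
    rw [← he] at h1
    have h2 := mul_le_mul_of_nonneg_right hDb (sq_nonneg η)
    linarith
  have hVE : 0 < Vbar * (E / a) := by positivity
  have hW₂b : |W₂| ≤ b * η := by
    rw [abs_of_nonneg hsq0]
    refine hsq.trans (mul_le_mul_of_nonneg_right ?_ hη.le)
    linarith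
  have hW₃b : |W₃| ≤ b * η := by
    refine hthree.trans ((mul_le_mul_of_nonneg_left hsq hV.le).trans ?_)
    rw [← mul_assoc]
    refine mul_le_mul_of_nonneg_right ?_ hη.le
    linarith
  have hW₄b : |W₄| ≤ b * η ^ 2 := by
    rw [abs_of_nonneg hfour0]
    exact hfour.trans (mul_le_mul_of_nonneg_right hEb' (sq_nonneg η))
  have hI₁' : |-(2 * q 1 * W₁) + q 0 * W₂| ≤ D * e := by
    rwa [hq2, zero_sub] at hI₁
  obtain ⟨hres₂, hres₁⟩ := hexpand η W₁ W₂ W₃ W₄ T hη H.le_one (hI₁'.trans heb) (hI₂.trans heb)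
    (hI₃.trans heb) hW₂b hW₃b hW₄b (hT.trans hKb)
  exact ⟨hres₂, hres₁, hI₁, hI₂⟩

end Piston


/-! ### From `η` to the mass ratio `ε`. -/

theorem mainTheorem2 (vmin vmax Vbar : ℝ) (hvmin : 0 < vmin) (hvmax : vmin < vmax)
    (hV : 0 < Vbar) (hV' : Vbar < vmin / 3) (pminus pplus : ℝ → ℝ)
    (hminus : Piston.IsGasDensity vmin vmax pminus)
    (hplus : Piston.IsGasDensity vmin vmax pplus)
    (Q : ℕ → ℝ) (hQ : Q = Piston.Q vmin vmax pminus pplus) (hQ2 : Q 2 = 0) :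
    ∃ C > 0, ∃ c > 0, ∃ ε₀ > 0, ∀ m M ε : ℝ, 0 < m → 0 < M → ε = m / M → ε ≤ ε₀ →
      ∀ μ : MeasureTheory.Measure ℝ, Piston.IsStationary m M Vbar pminus pplus μ →
        |(∫ w, w ^ 2 ∂μ) - Q 3 / (2 * Q 1) * ε| ≤ C * ε ^ 2 ∧
        |(∫ w, w ∂μ) - Q 0 * Q 3 / (4 * Q 1 ^ 2) * ε| ≤ C * ε ^ 2 ∧
        |Q 2 - 2 * Q 1 * (∫ w, w ∂μ) + Q 0 * (∫ w, w ^ 2 ∂μ)| ≤ C * Real.exp (-c / ε) ∧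
        |2 * Q 1 * (∫ w, w ^ 2 ∂μ) - Q 0 * (∫ w, w ^ 3 ∂μ) -
            m / (M + m) * (Q 3 + 3 * Q 1 * (∫ w, w ^ 2 ∂μ) - Q 0 * (∫ w, w ^ 3 ∂μ))|
          ≤ C * Real.exp (-c / ε) := by
  obtain ⟨D, hD0, c, hc0, C₀, hC₀, hbounds⟩ :=
    Piston.exists_moment_bounds hvmin hvmax hV hminus hplus hQ hQ2
  set K := vmax + Vbar with hK
  have hKpos : 0 < K := by linarith
  -- Because η ≤ 2ε, the first entry gives `small_kick` and the second `no_recollision`.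
  set ε₀ := min (Vbar / (4 * K)) ((vmin - 3 * Vbar) / (4 * vmin)) with hε₀
  -- `4 * C₀` comes from η² ≤ 4ε², the two absolute values from replacing η/2 by ε at cost ε², and
  -- `c / 2` from η ≤ 2ε.
  refine ⟨D + 4 * C₀ + |Q 3 / (2 * Q 1)| + |Q 0 * Q 3 / (4 * Q 1 ^ 2)|, by positivity, c / 2,
    by positivity, ε₀,
    lt_min (by positivity) (div_pos (by linarith) (by positivity)), ?_⟩
  intro m M ε hm hM hε hεle μ hμ
  have hε0 : 0 < ε := hε ▸ div_pos hm hM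
  set η := 2 * m / (M + m) with hη_def
  have hη : 0 < η := by positivity
  have hηε : η = 2 * ε / (1 + ε) := by
    rw [hη_def, hε]
    field_simp
  have hη2 : η ≤ 2 * ε := by
    rw [hηε]
    exact div_le_self (by positivity) (by linarith)
  have hεη : |η / 2 - ε| ≤ ε ^ 2 := by
    have : η / 2 - ε = -(ε ^ 2 / (1 + ε)) := by rw [hηε]; field_simp; ring
    rw [this, abs_neg, abs_of_pos (by positivity)]
    exact div_le_self (by positivity) (by linarith)
  have hmη : m / (M + m) = η / 2 := by rw [hη_def]; ring
  have H : Piston.IsHeavy vmin vmax Vbar η := by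
    have h1 := (le_div_iff₀ (by positivity)).1 (hεle.trans (min_le_left _ _))
    have h2 := (le_div_iff₀ (by positivity)).1
      (hεle.trans (min_le_right _ _))
    refine ⟨hvmin, hvmax, hV, hη, ?_, ?_⟩
    · nlinarith [mul_le_mul_of_nonneg_right hη2 hvmin.le]
    · nlinarith [mul_le_mul_of_nonneg_right hη2 hKpos.le]
  have hinv := hμ.isGeneratorInvariant hminus hplus (by positivity) H
  rw [← hη_def] at hinv
  obtain ⟨hres₂, hres₁, hI₁, hI₂⟩ := hbounds η H μ hinv
  have hηsq : C₀ * η ^ 2 ≤ 4 * C₀ * ε ^ 2 := by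
    have : η ^ 2 ≤ (2 * ε) ^ 2 := pow_le_pow_left₀ hη.le hη2 2
    nlinarith
  have hconv : ∀ {W q : ℝ}, |W - q / 2 * η| ≤ C₀ * η ^ 2 →
      |W - q * ε| ≤ 4 * C₀ * ε ^ 2 + |q| * ε ^ 2 := by
    intro W q hW
    have h1 : W - q * ε = (W - q / 2 * η) + q * (η / 2 - ε) := by ring
    rw [h1]
    refine (abs_add_le _ _).trans (add_le_add (hW.trans hηsq) ?_)
    rw [abs_mul]
    exact mul_le_mul_of_nonneg_left hεη (abs_nonneg _)
  have he0 : 0 < Real.exp (-c / η) := Real.exp_pos _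
  have hexp : Real.exp (-c / η) ≤ Real.exp (-(c / 2) / ε) := by
    rw [Real.exp_le_exp, neg_div, neg_div, neg_le_neg_iff, div_div]
    exact div_le_div_of_nonneg_left hc0.le hη hη2
  have hCexp : D * Real.exp (-c / η) ≤ (D + 4 * C₀ + |Q 3 / (2 * Q 1)| + |Q 0 * Q 3 / (4 * Q 1 ^ 2)|) *
      Real.exp (-(c / 2) / ε) := by
    refine mul_le_mul ?_ hexp he0.le (by positivity)
    linarith [abs_nonneg (Q 3 / (2 * Q 1)), abs_nonneg (Q 0 * Q 3 / (4 * Q 1 ^ 2))]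
  set W₂ := ∫ u, u ^ 2 ∂μ
  set W₃ := ∫ u, u ^ 3 ∂μ
  have hDε : 0 ≤ D * ε ^ 2 := by positivity
  have hr₁ : 0 ≤ |Q 3 / (2 * Q 1)| * ε ^ 2 := by positivity
  have hr₂ : 0 ≤ |Q 0 * Q 3 / (4 * Q 1 ^ 2)| * ε ^ 2 := by positivity
  refine ⟨?_, ?_, hI₁.trans hCexp, ?_⟩
  · refine (hconv (q := Q 3 / (2 * Q 1)) ?_).trans (by linarith)
    rwa [div_div, show 2 * Q 1 * 2 = 4 * Q 1 by ring]
  · refine (hconv (q := Q 0 * Q 3 / (4 * Q 1 ^ 2)) ?_).trans (by linarith)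
    rwa [div_div, show 4 * Q 1 ^ 2 * 2 = 8 * Q 1 ^ 2 by ring]
  · refine le_trans ?_ hCexp
    rw [hmη]
    -- The stated identity is -1/2 times the equation for the test function w².
    have h1 : 2 * Q 1 * W₂ - Q 0 * W₃ - η / 2 * (Q 3 + 3 * Q 1 * W₂ - Q 0 * W₃) =
        -(1 / 2) * (2 * (-(2 * Q 1 * W₂) + Q 0 * W₃) +
          η * (Q 3 + 3 * Q 1 * W₂ - Q 0 * W₃)) := by ring
    rw [h1, abs_mul]
    have h2 : |(-(1 / 2) : ℝ)| = 1 / 2 := by norm_num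
    rw [h2]
    have := mul_pos hD0 he0
    linarith
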